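/- Let $M_0=G/H$ be a Riemannian symmetric space, $o\in M_0$, with Cartan decomposition $\mathfrak g=\mathfrak h\oplus\mathfrak m$, $\mathfrak m=T_oM_0$ (that is, $(\mathfrak g,\theta,\langle\cdot,\cdot\rangle)$ is an effective orthogonal symmetric Lie algebra: $\mathfrak h$ and $\mathfrak m$ are the $+1$ and $-1$ eigenspaces of an involutive automorphism $\theta$ of the real Lie algebra $\mathfrak g$, and $\mathfrak h$ acts on the finite-dimensional Euclidean space $\mathfrak m$ faithfully and by skew-symmetric operators $\mathrm{ad}_A X=[A,X]$). The curvature tensor at $o$ is $R_0(X,Y)=-\mathrm{ad}_{[X,Y]}$. Let $\mathfrak m=\bigoplus_{s=1}^N\mathfrak m_s$, $N\ge 2$, be the orthogonal decomposition corresponding to the de Rham decomposition of $M_0$ into irreducible factors $M_s$ (each $\mathfrak m_s=T_oM_s$ is nonzero, invariant and irreducible under the holonomy algebra, which is spanned by the operators $R_0(X,Y)$), and suppose that no $M_s$ has constant curvature (a one-dimensional factor counts as having constant curvature). Let $\mathfrak h_s=[\mathfrak m_s,\mathfrak m_s]\subset\mathfrak h$ be the isotropy algebra of $M_s$. Write $(X\wedge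 Y)Z=\langle X,Z\rangle Y-\langle Y,Z\rangle X$, let $\sigma_{XYZ}$ denote the sum over the cyclic permutations of $X,Y,Z$, let $n=\dim\mathfrak m$, and let $\rho_0=\frac1{n-2}\mathrm{Ric}_0-\frac{\mathrm{scal}_0}{2(n-1)(n-2)}\,\mathrm{id}$, where $\mathrm{Ric}_0$ and $\mathrm{scal}_0$ are the Ricci operator and the scalar curvature of $M_0$ at $o$. Let $K\in\mathrm{Hom}(\mathfrak m,\mathfrak{so}(\mathfrak m))$, $Z\mapsto K_Z$, and $\Psi\in\mathrm{Hom}(\Lambda^2\mathfrak m,\mathfrak m)$ satisfy, for all $X,Y,Z\in\mathfrak m$, $$\sigma_{XYZ}\langle\Psi(X,Y),Z\rangle=0,\qquad \sigma_{XYZ}\big([\mathrm{ad}_{[X,Y]},K_Z]+\mathrm{ad}_{[K_XY-K_YX,Z]}+\Psi(X,Y)\wedge Z\big)=0,$$ and let $\Phi$ be defined by $\Psi(X,Y)=\Phi(X,Y)+[\rho_0,K_X]Y-[\rho_0,K_Y]X$. Then: 1. $\Psi=\Phi=0$. 2. $K\in\mathrm{Hom}\big(\mathfrak m,\bigoplus_{s=1}^N\mathfrak{so}(\mathfrak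 m_s)\big)$, that is, $K_Z\mathfrak m_s\subset\mathfrak m_s$ for all $Z\in\mathfrak m$ and all $s$; and for all $s\ne r$ there exists a linear map $P_{sr}:\mathfrak m_r\to\mathfrak h_s$ such that $(K_Z)|_{\mathfrak m_s}=\mathrm{ad}_{P_{sr}Z}|_{\mathfrak m_s}$ for all $Z\in\mathfrak m_r$. -/

import Mathlib

/-!
A Riemannian symmetric space `M₀ = G/H` with base point `o` is described by its Cartan decomposition
`𝔤 = 𝔥 ⊕ 𝔪`, `𝔪 = T_o M₀`, that is, by an effective orthogonal symmetric Lie algebra: a real Lie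
algebra `𝔤` with an involutive automorphism `θ`, whose `+1` eigenspace is the isotropy algebra `𝔥`
and whose `-1` eigenspace is `𝔪`, and a Euclidean inner product on `𝔪` for which `𝔥` acts by
skew-symmetric operators, faithfully.
-/

open scoped InnerProductSpace

noncomputable section

section Involution

variable {𝔤 : Type*} [LieRing 𝔤] [LieAlgebra ℝ 𝔤]

/-- The `+1` eigenspace `𝔥` of a Lie algebra endomorphism, a subalgebra. -/
def plusPart (θ : 𝔤 →ₗ⁅ℝ⁆ 𝔤) : LieSubalgebra ℝ 𝔤 where
  carrier := {x | θ x = x}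
  add_mem' := fun {a b} (ha : θ a = a) (hb : θ b = b) =>
    show θ (a + b) = a + b by rw [map_add, ha, hb]
  zero_mem' := map_zero θ
  smul_mem' := fun c x (hx : θ x = x) => show θ (c • x) = c • x by rw [map_smul, hx]
  lie_mem' := fun {a b} (ha : θ a = a) (hb : θ b = b) =>
    show θ ⁅a, b⁆ = ⁅a, b⁆ by rw [LieHom.map_lie, ha, hb]

/-- The `-1` eigenspace `𝔪` of a Lie algebra endomorphism. -/
def minusPart (θ : 𝔤 →ₗ⁅ℝ⁆ 𝔤) : Submodule ℝ 𝔤 where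
  carrier := {x | θ x = -x}
  add_mem' := fun {a b} (ha : θ a = -a) (hb : θ b = -b) =>
    show θ (a + b) = -(a + b) by rw [map_add, ha, hb, neg_add]
  zero_mem' := show θ 0 = -0 by simp
  smul_mem' := fun c x (hx : θ x = -x) => show θ (c • x) = -(c • x) by rw [map_smul, hx, smul_neg]

theorem mem_plusPart {θ : 𝔤 →ₗ⁅ℝ⁆ 𝔤} {x : 𝔤} : x ∈ plusPart θ ↔ θ x = x := Iff.rfl

theorem mem_minusPart {θ : 𝔤 →ₗ⁅ℝ⁆ 𝔤} {x : 𝔤} : x ∈ minusPart θ ↔ θ x = -x := Iff.rfl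

/-- `[𝔥, 𝔪] ⊆ 𝔪`. -/
theorem lie_mem_minusPart {θ : 𝔤 →ₗ⁅ℝ⁆ 𝔤} {a x : 𝔤} (ha : a ∈ plusPart θ)
    (hx : x ∈ minusPart θ) : ⁅a, x⁆ ∈ minusPart θ := by
  rw [mem_plusPart] at ha
  rw [mem_minusPart] at *
  rw [LieHom.map_lie, ha, hx, lie_neg]

/-- `[𝔪, 𝔪] ⊆ 𝔥`. -/
theorem lie_mem_plusPart {θ : 𝔤 →ₗ⁅ℝ⁆ 𝔤} {x y : 𝔤} (hx : x ∈ minusPart θ)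
    (hy : y ∈ minusPart θ) : ⁅x, y⁆ ∈ plusPart θ := by
  rw [mem_minusPart] at hx hy
  rw [mem_plusPart, LieHom.map_lie, hx, hy, neg_lie, lie_neg, neg_neg]

/-- The isotropy representation `𝔥 → End 𝔪`, `A ↦ ad_A`. -/
def isotropyRep (θ : 𝔤 →ₗ⁅ℝ⁆ 𝔤) : plusPart θ →ₗ[ℝ] Module.End ℝ (minusPart θ) :=
  LinearMap.mk₂ ℝ (fun A X => ⟨⁅(A : 𝔤), (X : 𝔤)⁆, lie_mem_minusPart A.2 X.2⟩)
    (fun A B X => Subtype.ext (by simp)) (fun c A X => Subtype.ext (by simp))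
    (fun A X Y => Subtype.ext (by simp)) (fun c A X => Subtype.ext (by simp))

/-- The bracket `𝔪 × 𝔪 → 𝔥`. -/
def minusBracket (θ : 𝔤 →ₗ⁅ℝ⁆ 𝔤) : minusPart θ →ₗ[ℝ] minusPart θ →ₗ[ℝ] plusPart θ :=
  LinearMap.mk₂ ℝ (fun X Y => ⟨⁅(X : 𝔤), (Y : 𝔤)⁆, lie_mem_plusPart X.2 Y.2⟩)
    (fun X X' Y => Subtype.ext (by simp)) (fun c X Y => Subtype.ext (by simp))
    (fun X Y Y' => Subtype.ext (by simp)) (fun c X Y => Subtype.ext (by simp))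

end Involution

/-- The infinitesimal form of a Riemannian symmetric space `M₀ = G/H`: an effective orthogonal
symmetric Lie algebra. Here `𝔤` is the Lie algebra of `G`, the Euclidean space `T` is the tangent
space `T_o M₀` with the Riemannian metric at `o`, and `toM` is the identification `T_o M₀ = 𝔪`. -/
structure RiemannianSymmetricAlgebra (𝔤 T : Type*) [LieRing 𝔤] [LieAlgebra ℝ 𝔤]
    [NormedAddCommGroup T] [InnerProductSpace ℝ T] where
  /-- the Cartan involution: the differential at the identity of the conjugation by the geodesic
  symmetry at `o` -/
  θ : 𝔤 →ₗ⁅ℝ⁆ 𝔤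
  θ_θ : ∀ x, θ (θ x) = x
  /-- the identification of the tangent space with `𝔪` -/
  toM : T ≃ₗ[ℝ] minusPart θ
  /-- invariance of the metric under the isotropy algebra -/
  skew : ∀ (A : plusPart θ) (X Y : T),
    ⟪toM.symm (isotropyRep θ A (toM X)), Y⟫_ℝ + ⟪X, toM.symm (isotropyRep θ A (toM Y))⟫_ℝ = 0
  /-- `G` acts effectively: only zero acts trivially on `T_o M₀` among the elements of `𝔥` -/
  effective : ∀ A : plusPart θ, isotropyRep θ A = 0 → A = 0

/-- `(X ∧ Y) Z = ⟨X, Z⟩ Y - ⟨Y, Z⟩ X`. -/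
def wedgeOp {T : Type*} [NormedAddCommGroup T] [InnerProductSpace ℝ T] (X Y : T) :
    Module.End ℝ T :=
  (innerₛₗ ℝ X).smulRight Y - (innerₛₗ ℝ Y).smulRight X

namespace RiemannianSymmetricAlgebra

variable {𝔤 T : Type*} [LieRing 𝔤] [LieAlgebra ℝ 𝔤] [NormedAddCommGroup T] [InnerProductSpace ℝ T]
  (S : RiemannianSymmetricAlgebra 𝔤 T)

/-- The isotropy algebra `𝔥`. -/
abbrev 𝔥 : LieSubalgebra ℝ 𝔤 := plusPart S.θ

/-- `ad_A`, for `A ∈ 𝔥`, as an operator on `T_o M₀ = 𝔪`. -/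
def ad : S.𝔥 →ₗ[ℝ] Module.End ℝ T :=
  S.toM.symm.conj.toLinearMap ∘ₗ isotropyRep S.θ

/-- The bracket `[X, Y] ∈ 𝔥` of two tangent vectors `X, Y ∈ T_o M₀ = 𝔪`. -/
def bracket : T →ₗ[ℝ] T →ₗ[ℝ] S.𝔥 :=
  (minusBracket S.θ).compl₁₂ S.toM.toLinearMap S.toM.toLinearMap

/-- The curvature tensor at `o`: `R₀(X, Y) = -ad_{[X, Y]}`. -/
def curvature : T →ₗ[ℝ] T →ₗ[ℝ] Module.End ℝ T :=
  -(S.bracket.compr₂ S.ad)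

/-- The Ricci operator `Ric₀ X = ∑ᵢ R₀(X, eᵢ) eᵢ`, with `eᵢ` an orthonormal basis. -/
def ricci [FiniteDimensional ℝ T] : Module.End ℝ T :=
  ∑ i, (S.curvature.flip (stdOrthonormalBasis ℝ T i)).flip (stdOrthonormalBasis ℝ T i)

/-- The scalar curvature. -/
def scal [FiniteDimensional ℝ T] : ℝ := LinearMap.trace ℝ T S.ricci

/-- The Schouten operator `ρ₀ = Ric₀ / (n - 2) - scal₀ / (2 (n - 1) (n - 2)) id`, `n = dim M₀`. -/
def schouten [FiniteDimensional ℝ T] : Module.End ℝ T :=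
  (1 / ((Module.finrank ℝ T : ℝ) - 2)) • S.ricci
    - (S.scal / (2 * ((Module.finrank ℝ T : ℝ) - 1) * ((Module.finrank ℝ T : ℝ) - 2))) • 1

/-- `W` is invariant under the holonomy algebra of `M₀` at `o`, which is spanned by the curvature
operators `R₀(X, Y)`. -/
def IsHolonomyInvariant (W : Submodule ℝ T) : Prop :=
  ∀ X Y : T, ∀ V ∈ W, S.curvature X Y V ∈ W

/-- `T_o M₀ = 𝔪 = ⨁ₛ 𝔪ₛ` is an orthogonal decomposition into tangent spaces of irreducible de Rham
factors: holonomy-invariant, holonomy-irreducible subspaces. (A Euclidean factor, if any, is split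
here into lines.) -/
structure IsDeRhamDecomposition {N : ℕ} (𝔪 : Fin N → Submodule ℝ T) : Prop where
  internal : DirectSum.IsInternal 𝔪
  orthogonal : ∀ r s, r ≠ s → 𝔪 r ⟂ 𝔪 s
  invariant : ∀ s, S.IsHolonomyInvariant (𝔪 s)
  ne_bot : ∀ s, 𝔪 s ≠ ⊥
  irreducible : ∀ s (W : Submodule ℝ T), W ≤ 𝔪 s → S.IsHolonomyInvariant W → W = ⊥ ∨ W = 𝔪 s

/-- The factor with tangent space `W` has constant curvature (a one-dimensional factor always
does). -/
def HasConstantCurvature (W : Submodule ℝ T) : Prop :=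
  ∃ c : ℝ, ∀ X ∈ W, ∀ Y ∈ W, ∀ Z ∈ W,
    S.curvature X Y Z = c • (⟪Y, Z⟫_ℝ • X - ⟪X, Z⟫_ℝ • Y)

/-- The isotropy algebra `𝔥ₛ = [𝔪ₛ, 𝔪ₛ]` of the factor with tangent space `W = 𝔪ₛ` (for an
irreducible factor that is not flat, this is the whole isotropy algebra of the factor). -/
def factorIsotropy (W : Submodule ℝ T) : Submodule ℝ S.𝔥 :=
  Submodule.span ℝ {A | ∃ X ∈ W, ∃ Y ∈ W, S.bracket X Y = A}

/-- The term `[ad_{[X, Y]}, K_Z] + ad_{[K_X Y - K_Y X, Z]} + Ψ(X, Y) ∧ Z`, to be summed over the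
cyclic permutations of `X, Y, Z`. -/
def bianchiTerm (K : T →ₗ[ℝ] Module.End ℝ T) (Ψ : T [⋀^Fin 2]→ₗ[ℝ] T) (X Y Z : T) :
    Module.End ℝ T :=
  ⁅S.ad (S.bracket X Y), K Z⁆ + S.ad (S.bracket (K X Y - K Y X) Z) + wedgeOp (Ψ ![X, Y]) Z

end RiemannianSymmetricAlgebra

end

noncomputable section

/-! ### Algebraic properties of the curvature tensor and of invariant subspaces. -/

namespace RiemannianSymmetricAlgebra

variable {𝔤 T : Type*} [LieRing 𝔤] [LieAlgebra ℝ 𝔤] [NormedAddCommGroup T] [InnerProductSpace ℝ T]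
  (S : RiemannianSymmetricAlgebra 𝔤 T)

/-! Write `R` for the curvature and `Q` for `Ψ` as a bilinear map. Fix a factor `W` and project the
Bianchi identity for `X, Z ∈ W` and `Y, U ∈ Wᗮ` to `W`. If `Y ⟂ U`, then `w = pr_W (K_Y U)`
satisfies an equation `R(X, Z) w = f(X) Z - f(Z) X`. Irreducibility and nonconstant curvature force
`w = 0` and `f = 0` (`eq_zero_of_curvature_apply_eq`). Hence on `Wᗮ` the mixed components are
multiples of the metric: `⟨K_Y U, Z⟩ = ⟨Y, U⟩⟨w, Z⟩` and `⟨Q(Y, Z), U⟩ = ⟨Y, U⟩ f(Z)`.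

To remove these multiples, fix `Z ∈ W` and let `D` be the compression of `K_Z` to `Wᗮ`. The identity
with three arguments in `Wᗮ` becomes `D·R = G`, where `G` is a combination of `R` and the constant
curvature tensor. Since `D` kills the latter, `G` is an eigentensor of `D`. As `D` acts on tensors
skew-symmetrically, `G = 0` (`derivAlong_eq_zero`). Since `Wᗮ` contains another factor, it has
nonconstant curvature, so both coefficients vanish. Thus `K` is block-diagonal, and the cyclic
identity gives `Ψ = 0`. Factors are Einstein, so `ρ₀` commutes with block-diagonal operators and `Φ
= Ψ = 0`.

With `Q = 0`, the identity says that `K_Z`, for `Z` in another factor, is a skew derivation of the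
curvature of `W`. Such a derivation lies in the isotropy algebra (`exists_ad_eq_of_derivation`),
because a factor of nonconstant curvature is Einstein with nonzero constant. -/

theorem coe_toM_ad (A : S.𝔥) (X : T) : (S.toM (S.ad A X) : 𝔤) = ⁅(A : 𝔤), (S.toM X : 𝔤)⁆ := by
  simp [ad, isotropyRep, LinearEquiv.conj_apply]

theorem coe_bracket (X Y : T) : (S.bracket X Y : 𝔤) = ⁅(S.toM X : 𝔤), (S.toM Y : 𝔤)⁆ := by
  simp [bracket, minusBracket]

theorem ad_bracket (X Y : T) : S.ad (S.bracket X Y) = -S.curvature X Y := by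
  simp [curvature]

theorem toM_injective {X Y : T} (h : (S.toM X : 𝔤) = S.toM Y) : X = Y :=
  S.toM.injective (Subtype.ext h)

theorem inner_ad (A : S.𝔥) (X Y : T) : ⟪S.ad A X, Y⟫_ℝ = -⟪X, S.ad A Y⟫_ℝ := by
  have := S.skew A X Y
  simp only [ad, LinearMap.comp_apply, LinearEquiv.coe_coe, LinearEquiv.conj_apply,
    LinearEquiv.symm_symm]
  linarith

theorem ad_injective : Function.Injective S.ad := by
  refine (injective_iff_map_eq_zero _).2 fun A hA => S.effective A ?_
  ext X
  obtain ⟨X, rfl⟩ := S.toM.surjective X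
  have := S.coe_toM_ad A X
  rw [hA] at this
  simpa [isotropyRep] using this.symm

theorem ad_lie (A B : S.𝔥) : S.ad ⁅A, B⁆ = ⁅S.ad A, S.ad B⁆ := by
  ext X
  apply S.toM_injective
  simp [LieRing.of_associative_ring_bracket, coe_toM_ad]

theorem ad_ad_bracket (A : S.𝔥) (X Y : T) :
    ⁅A, S.bracket X Y⁆ = S.bracket (S.ad A X) Y + S.bracket X (S.ad A Y) := by
  ext
  simp [coe_bracket, coe_toM_ad]

theorem curvature_swap (X Y : T) : S.curvature X Y = -S.curvature Y X := by
  have : S.bracket X Y = -S.bracket Y X := by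
    ext
    simp [coe_bracket]
  simp [curvature, this]

theorem inner_curvature (X Y U V : T) :
    ⟪S.curvature X Y U, V⟫_ℝ = -⟪U, S.curvature X Y V⟫_ℝ := by
  simp [curvature, S.inner_ad]

theorem curvature_bianchi (X Y Z : T) :
    S.curvature X Y Z + S.curvature Y Z X + S.curvature Z X Y = 0 := by
  apply S.toM_injective
  have := lie_jacobi (S.toM Z : 𝔤) (S.toM X) (S.toM Y)
  simp only [curvature, LinearMap.neg_apply, LinearMap.compr₂_apply, map_add, map_neg, coe_toM_ad,
    coe_bracket, Submodule.coe_add, Submodule.coe_neg, map_zero, Submodule.coe_zero]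
  rw [lie_skew, lie_skew, lie_skew, ← this]

/-- The usual consequence of the skew symmetries and four instances of the first Bianchi identity.
-/
theorem curvature_pair (X Y U V : T) :
    ⟪S.curvature X Y U, V⟫_ℝ = ⟪S.curvature U V X, Y⟫_ℝ := by
  have b : ∀ X Y Z V : T, ⟪S.curvature X Y Z, V⟫_ℝ + ⟪S.curvature Y Z X, V⟫_ℝ
      + ⟪S.curvature Z X Y, V⟫_ℝ = 0 := fun X Y Z V => by
    rw [← inner_add_left, ← inner_add_left, S.curvature_bianchi, inner_zero_left]
  have s : ∀ X Y U V : T, ⟪S.curvature X Y U, V⟫_ℝ = -⟪S.curvature X Y V, U⟫_ℝ :=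
    fun X Y U V => by rw [S.inner_curvature, real_inner_comm]
  have t : ∀ X Y U V : T, ⟪S.curvature X Y U, V⟫_ℝ = -⟪S.curvature Y X U, V⟫_ℝ :=
    fun X Y U V => by rw [S.curvature_swap]; simp
  linarith [b X Y U V, b Y U V X, b U V X Y, b V X Y U, s X Y U V, s Y U X V, s U X Y V, s Y U V X,
    s U V Y X, s V Y U X, s U V X Y, s V X U Y, s X U V Y, s V X Y U, s X Y V U, s Y V X U,
    t X Y U V, t Y U X V, t U X Y V, t U V X Y, t V X U Y, t X U V Y, t V Y U X, t Y V X U]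

/-- The curvature tensor is invariant under the isotropy algebra. -/
theorem ad_curvature (A : S.𝔥) (X Y Z : T) :
    S.ad A (S.curvature X Y Z) = S.curvature (S.ad A X) Y Z + S.curvature X (S.ad A Y) Z
      + S.curvature X Y (S.ad A Z) := by
  have h := LinearMap.congr_fun (S.ad_lie A (S.bracket X Y)) Z
  rw [ad_ad_bracket, map_add, ad_bracket, ad_bracket, ad_bracket,
    LieRing.of_associative_ring_bracket] at h
  simp only [LinearMap.add_apply, LinearMap.neg_apply, LinearMap.sub_apply, Module.End.mul_apply,
    map_neg] at h
  linear_combination (norm := module) h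

theorem curvature_curvature (U V X Y Z : T) :
    S.curvature U V (S.curvature X Y Z) = S.curvature (S.curvature U V X) Y Z
      + S.curvature X (S.curvature U V Y) Z + S.curvature X Y (S.curvature U V Z) := by
  have h := S.ad_curvature (S.bracket U V) X Y Z
  simp only [ad_bracket, LinearMap.neg_apply, map_neg] at h
  linear_combination (norm := module) (-1 : ℝ) • h

variable {S}

theorem IsHolonomyInvariant.orthogonal {W : Submodule ℝ T} (hW : S.IsHolonomyInvariant W) :
    S.IsHolonomyInvariant Wᗮ := by
  intro X Y V hV
  rw [Submodule.mem_orthogonal] at hV ⊢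
  intro u hu
  have := S.inner_curvature X Y u V
  rw [hV _ (hW X Y u hu)] at this
  linarith

theorem IsHolonomyInvariant.curvature_eq_zero {W : Submodule ℝ T} (hW : S.IsHolonomyInvariant W)
    {X Y : T} (hX : X ∈ W) (hY : Y ∈ Wᗮ) : S.curvature X Y = 0 := by
  ext U
  refine ext_inner_right ℝ fun V => ?_
  rw [S.curvature_pair, Submodule.inner_right_of_mem_orthogonal (hW _ _ _ hX) hY]
  simp

theorem IsHolonomyInvariant.curvature_eq_zero' {W : Submodule ℝ T} (hW : S.IsHolonomyInvariant W)
    {X Y : T} (hX : X ∈ Wᗮ) (hY : Y ∈ W) : S.curvature X Y = 0 := by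
  rw [curvature_swap, hW.curvature_eq_zero hY hX, neg_zero]

/-- By invariance the vector lies in `Wᗮ`; by the first Bianchi identity it equals `-R(Z, U) X`,
which lies in `W`. -/
theorem IsHolonomyInvariant.curvature_apply_eq_zero {W : Submodule ℝ T}
    (hW : S.IsHolonomyInvariant W) {X U : T} (hX : X ∈ W) (hU : U ∈ Wᗮ) (Z : T) :
    S.curvature X Z U = 0 := by
  have h1 : S.curvature X Z U ∈ Wᗮ := hW.orthogonal _ _ _ hU
  have h2 : S.curvature X Z U ∈ W := by
    have h := S.curvature_bianchi X Z U
    rw [hW.curvature_eq_zero' hU hX, LinearMap.zero_apply, add_zero] at h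
    rw [eq_neg_of_add_eq_zero_left h]
    exact W.neg_mem (hW _ _ _ hX)
  exact inner_self_eq_zero.1 (Submodule.inner_right_of_mem_orthogonal h2 h1)

theorem IsHolonomyInvariant.curvature_apply_eq_zero' {W : Submodule ℝ T}
    (hW : S.IsHolonomyInvariant W) {X U : T} (hX : X ∈ W) (hU : U ∈ Wᗮ) (Z : T) :
    S.curvature Z X U = 0 := by
  rw [curvature_swap, LinearMap.neg_apply, hW.curvature_apply_eq_zero hX hU, neg_zero]

theorem HasConstantCurvature.mono {V W : Submodule ℝ T} (h : S.HasConstantCurvature V)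
    (hWV : W ≤ V) : S.HasConstantCurvature W := by
  obtain ⟨c, hc⟩ := h
  exact ⟨c, fun X hX Y hY Z hZ => hc X (hWV hX) Y (hWV hY) Z (hWV hZ)⟩

/-- A subspace of nonconstant curvature is at least two-dimensional. -/
theorem exists_orthogonal_pair {W : Submodule ℝ T} (h : ¬ S.HasConstantCurvature W) :
    ∃ X ∈ W, ∃ Y ∈ W, X ≠ 0 ∧ Y ≠ 0 ∧ ⟪X, Y⟫_ℝ = 0 := by
  by_contra! hn
  -- Without such a pair, `W` is at most a line, so its curvature vanishes.
  refine h ⟨0, fun X hX Y hY Z _ => ?_⟩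
  rw [zero_smul]
  by_cases hX0 : X = 0
  · simp [hX0]
  have hXX : ⟪X, X⟫_ℝ ≠ 0 := inner_self_ne_zero.2 hX0
  have hY0 : Y - (⟪X, Y⟫_ℝ / ⟪X, X⟫_ℝ) • X = 0 := by
    by_contra hne
    refine hn X hX _ (W.sub_mem hY (W.smul_mem _ hX)) hX0 hne ?_
    rw [inner_sub_right, inner_smul_right]
    field_simp
    simp
  have hXX0 : S.curvature X X Z = 0 := by
    have h2 := LinearMap.congr_fun (S.curvature_swap X X) Z
    rw [LinearMap.neg_apply] at h2
    linear_combination (norm := module) (1 / 2 : ℝ) • h2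
  rw [sub_eq_zero.1 hY0, map_smul, LinearMap.smul_apply, hXX0, smul_zero]

/-- In an irreducible factor of nonconstant curvature no vector `w` has a curvature of the form
`R(X, Y) w = f(X) Y - f(Y) X`. -/
theorem eq_zero_of_curvature_apply_eq {W : Submodule ℝ T} (hW : S.IsHolonomyInvariant W)
    (hirr : ∀ W' ≤ W, S.IsHolonomyInvariant W' → W' = ⊥ ∨ W' = W)
    (hcurv : ¬ S.HasConstantCurvature W) (f : T →ₗ[ℝ] ℝ) {w : T} (hw : w ∈ W)
    (h : ∀ X ∈ W, ∀ Y ∈ W, S.curvature X Y w = f X • Y - f Y • X) :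
    w = 0 ∧ ∀ X ∈ W, f X = 0 := by
  have hw0 : w = 0 := by
    by_contra hw0
    have hww : ⟪w, w⟫_ℝ ≠ 0 := inner_self_ne_zero.2 hw0
    set c := f w / ⟪w, w⟫_ℝ with hc
    -- This is `⟨R(X, w) w, w⟩ = 0`.
    have hf : ∀ X ∈ W, f X = c * ⟪X, w⟫_ℝ := by
      intro X hX
      have h1 := S.inner_curvature X w w w
      rw [real_inner_comm] at h1
      rw [h X hX w hw, inner_sub_right, inner_smul_right, inner_smul_right,
        real_inner_comm X w] at h1
      rw [hc]
      field_simp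
      linarith
    -- The vectors on which `R` looks like constant curvature. This space is invariant since both
    -- `R` and the metric are, and it contains `w`, so it is all of `W`.
    let W' : Submodule ℝ T :=
      { carrier := {v | v ∈ W ∧ ∀ X ∈ W, ∀ Y ∈ W,
          S.curvature X Y v = c • (⟪X, v⟫_ℝ • Y - ⟪Y, v⟫_ℝ • X)}
        add_mem' := by
          rintro a b ⟨ha, ha'⟩ ⟨hb, hb'⟩
          refine ⟨W.add_mem ha hb, fun X hX Y hY => ?_⟩
          rw [map_add, ha' X hX Y hY, hb' X hX Y hY, inner_add_right, inner_add_right]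
          module
        zero_mem' := ⟨W.zero_mem, fun X _ Y _ => by simp⟩
        smul_mem' := by
          rintro r a ⟨ha, ha'⟩
          refine ⟨W.smul_mem r ha, fun X hX Y hY => ?_⟩
          rw [map_smul, ha' X hX Y hY, inner_smul_right, inner_smul_right]
          module }
    have hW' : S.IsHolonomyInvariant W' := by
      rintro U V v ⟨hv, hv'⟩
      refine ⟨hW _ _ _ hv, fun X hX Y hY => ?_⟩
      have h1 := S.curvature_curvature U V X Y v
      rw [hv' X hX Y hY, hv' _ (hW U V X hX) Y hY, hv' X hX _ (hW U V Y hY), S.inner_curvature U V X,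
        S.inner_curvature U V Y] at h1
      rw [← add_right_inj, ← h1]
      simp only [map_smul, map_sub]
      module
    have hwW' : w ∈ W' := ⟨hw, fun X hX Y hY => by
      rw [h X hX Y hY, hf X hX, hf Y hY]
      module⟩
    rcases hirr W' (fun v hv => hv.1) hW' with h0 | h1
    · rw [h0] at hwW'
      exact hw0 hwW'
    · refine hcurv ⟨-c, fun X hX Y hY Z hZ => ?_⟩
      rw [← h1] at hZ
      rw [hZ.2 X hX Y hY]
      module
  refine ⟨hw0, fun X hX => ?_⟩
  -- Now `f(X) Y = f(Y) X` on `W`, so `f(X) ≠ 0` would make `W` a line.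
  by_contra hfX
  obtain ⟨A, hA, B, hB, hA0, hB0, hAB⟩ := exists_orthogonal_pair hcurv
  have hpar : ∀ Y ∈ W, Y = (f Y / f X) • X := by
    intro Y hY
    have h1 := h X hX Y hY
    rw [hw0, map_zero] at h1
    rw [div_eq_inv_mul, mul_smul, ← sub_eq_zero.1 h1.symm, smul_smul, inv_mul_cancel₀ hfX, one_smul]
  rw [hpar A hA, hpar B hB, inner_smul_left, inner_smul_right] at hAB
  simp only [RCLike.conj_to_real, mul_eq_zero, inner_self_eq_zero] at hAB
  rcases hAB with h1 | h1 | h1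
  · exact hA0 (by rw [hpar A hA, h1, zero_smul])
  · exact hB0 (by rw [hpar B hB, h1, zero_smul])
  · rw [h1, map_zero] at hfX
    exact hfX rfl

end RiemannianSymmetricAlgebra

/-! ### Linear algebra: bilinear maps, skew operators acting on tensors, trace forms. -/

section LinearAlgebra

variable {T : Type*} [NormedAddCommGroup T] [InnerProductSpace ℝ T]

/-- A bilinear map that vanishes on orthogonal pairs is a multiple of the inner product. -/
theorem exists_eq_inner_smul {E : Type*} [AddCommGroup E] [Module ℝ E] (V : Submodule ℝ T)
    (b : T →ₗ[ℝ] T →ₗ[ℝ] E) (hb : ∀ Y ∈ V, ∀ U ∈ V, ⟪Y, U⟫_ℝ = 0 → b Y U = 0) :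
    ∃ w, ∀ Y ∈ V, ∀ U ∈ V, b Y U = ⟪Y, U⟫_ℝ • w := by
  by_cases hV : V = ⊥
  · refine ⟨0, fun Y hY U _ => ?_⟩
    rw [hV, Submodule.mem_bot] at hY
    simp [hY]
  obtain ⟨e, heV, he0⟩ := (Submodule.ne_bot_iff _).1 hV
  have h1 : ∀ Y ∈ V, ∀ U ∈ V, ⟪U, U⟫_ℝ • b Y U = ⟪Y, U⟫_ℝ • b U U := by
    intro Y hY U hU
    have h := hb (⟪U, U⟫_ℝ • Y - ⟪Y, U⟫_ℝ • U) (V.sub_mem (V.smul_mem _ hY) (V.smul_mem _ hU)) U hU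
      (by rw [inner_sub_left, inner_smul_left, inner_smul_left]; simp; ring)
    rw [map_sub, map_smul, map_smul, LinearMap.sub_apply, LinearMap.smul_apply,
      LinearMap.smul_apply] at h
    exact sub_eq_zero.1 h
  have h2 : ∀ Y ∈ V, ∀ U ∈ V, ⟪Y, Y⟫_ℝ • b Y U = ⟪Y, U⟫_ℝ • b Y Y := by
    intro Y hY U hU
    have h := hb Y hY (⟪Y, Y⟫_ℝ • U - ⟪Y, U⟫_ℝ • Y) (V.sub_mem (V.smul_mem _ hU) (V.smul_mem _ hY))
      (by rw [inner_sub_right, inner_smul_right, inner_smul_right]; ring)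
    rw [map_sub, map_smul, map_smul] at h
    exact sub_eq_zero.1 h
  have h3 : ∀ Y ∈ V, ∀ U ∈ V, ⟪Y, U⟫_ℝ ≠ 0 → ⟪U, U⟫_ℝ • b Y Y = ⟪Y, Y⟫_ℝ • b U U := by
    intro Y hY U hU hYU
    have h : ⟪Y, U⟫_ℝ • (⟪U, U⟫_ℝ • b Y Y) = ⟪Y, U⟫_ℝ • (⟪Y, Y⟫_ℝ • b U U) := by
      rw [smul_comm, ← h2 Y hY U hU, smul_comm, h1 Y hY U hU, smul_comm]
    exact smul_right_injective E hYU h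
  have hee : ⟪e, e⟫_ℝ ≠ 0 := inner_self_ne_zero.2 he0
  have h4 : ∀ Y ∈ V, ⟪e, e⟫_ℝ • b Y Y = ⟪Y, Y⟫_ℝ • b e e := by
    intro Y hY
    by_cases hYe : ⟪Y, e⟫_ℝ = 0
    · have hYe' : ⟪e, Y⟫_ℝ = 0 := by rw [real_inner_comm, hYe]
      -- Orthogonal vectors are compared through `Y + e`, which is not orthogonal to `e`.
      have h := h3 (Y + e) (V.add_mem hY heV) e heV (by rwa [inner_add_left, hYe, zero_add])
      simp only [map_add, LinearMap.add_apply, hb Y hY e heV hYe, hb e heV Y hY hYe', inner_add_left,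
        inner_add_right, hYe, hYe', add_zero, zero_add, smul_add, add_smul] at h
      exact add_right_cancel h
    · exact h3 Y hY e heV hYe
  refine ⟨(⟪e, e⟫_ℝ)⁻¹ • b e e, fun Y hY U hU => ?_⟩
  by_cases hU0 : U = 0
  · simp [hU0]
  have hUU : ⟪U, U⟫_ℝ ≠ 0 := inner_self_ne_zero.2 hU0
  apply smul_right_injective E hUU
  apply smul_right_injective E hee
  change ⟪e, e⟫_ℝ • ⟪U, U⟫_ℝ • b Y U = ⟪e, e⟫_ℝ • ⟪U, U⟫_ℝ • ⟪Y, U⟫_ℝ • (⟪e, e⟫_ℝ)⁻¹ • b e e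
  rw [h1 Y hY U hU, smul_comm, h4 U hU]
  simp only [smul_smul]
  congr 1
  field_simp

variable [FiniteDimensional ℝ T]

/-- A skew matrix (that of `D`) is paired with a symmetric one (that of `β` symmetrized). This is
the one-slot case of the skewness of `D` on tensors. -/
theorem sum_skew_apply (V : Submodule ℝ T) (D : Module.End ℝ T) (hDV : ∀ x ∈ V, D x ∈ V)
    (hD : ∀ x y, ⟪D x, y⟫_ℝ = -⟪x, D y⟫_ℝ) (β : T →ₗ[ℝ] T →ₗ[ℝ] ℝ) :
    ∑ i, (β (stdOrthonormalBasis ℝ V i) (D (stdOrthonormalBasis ℝ V i))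
      + β (D (stdOrthonormalBasis ℝ V i)) (stdOrthonormalBasis ℝ V i)) = 0 := by
  set e := stdOrthonormalBasis ℝ V
  have hDe : ∀ i, D (e i) = ∑ j, ⟪(e j : T), D (e i)⟫_ℝ • (e j : T) := by
    intro i
    have h := e.sum_repr' ⟨D (e i), hDV _ (e i).2⟩
    have h' := congrArg (Submodule.subtype V) h
    simp only [map_sum, map_smul, Submodule.subtype_apply, Submodule.coe_inner] at h'
    exact h'.symm
  have h1 : ∀ i, β (e i) (D (e i)) + β (D (e i)) (e i)
      = ∑ j, ⟪(e j : T), D (e i)⟫_ℝ * (β (e i) (e j) + β (e j) (e i)) := by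
    intro i
    conv_lhs => rw [hDe i]
    simp only [map_sum, map_smul, LinearMap.sum_apply, LinearMap.smul_apply, smul_eq_mul, mul_add,
      Finset.sum_add_distrib]
  have h2 : ∑ i, ∑ j, ⟪(e j : T), D (e i)⟫_ℝ * (β (e i) (e j) + β (e j) (e i))
      = -∑ i, ∑ j, ⟪(e j : T), D (e i)⟫_ℝ * (β (e i) (e j) + β (e j) (e i)) := by
    conv_lhs => rw [Finset.sum_comm]
    simp only [← Finset.sum_neg_distrib]
    refine Finset.sum_congr rfl fun i _ => Finset.sum_congr rfl fun j _ => ?_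
    rw [← real_inner_comm, hD]
    ring
  rw [Finset.sum_congr rfl fun i _ => h1 i]
  linarith

/-- The derivative of a trilinear map along an endomorphism `D`. -/
def derivAlong (D : Module.End ℝ T) (F : T →ₗ[ℝ] T →ₗ[ℝ] Module.End ℝ T) (X Y U : T) : T :=
  D (F X Y U) - F (D X) Y U - F X (D Y) U - F X Y (D U)

/-- The inner product of the restrictions of two trilinear maps to a subspace. -/
def tensorInner (V : Submodule ℝ T) (F G : T → T → T → T) : ℝ :=
  ∑ i, ∑ j, ∑ k,
    ⟪F (stdOrthonormalBasis ℝ V i) (stdOrthonormalBasis ℝ V j) (stdOrthonormalBasis ℝ V k),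
      G (stdOrthonormalBasis ℝ V i) (stdOrthonormalBasis ℝ V j) (stdOrthonormalBasis ℝ V k)⟫_ℝ

/-- A skew-symmetric operator acts on trilinear maps by a skew-symmetric operator. -/
theorem tensorInner_derivAlong (V : Submodule ℝ T) (D : Module.End ℝ T) (hDV : ∀ x ∈ V, D x ∈ V)
    (hD : ∀ x y, ⟪D x, y⟫_ℝ = -⟪x, D y⟫_ℝ) (F G : T →ₗ[ℝ] T →ₗ[ℝ] Module.End ℝ T) :
    tensorInner V (fun X Y U => F X Y U) (derivAlong D G)
      + tensorInner V (derivAlong D F) (fun X Y U => G X Y U) = 0 := by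
  unfold tensorInner derivAlong
  have hs := sum_skew_apply V D hDV hD
  set e := stdOrthonormalBasis ℝ V
  let B (P Q : T →ₗ[ℝ] T) : T →ₗ[ℝ] T →ₗ[ℝ] ℝ := (innerₗ T).compl₁₂ P Q
  have hB : ∀ P Q x y, B P Q x y = ⟪P x, Q y⟫_ℝ := fun _ _ _ _ => rfl
  have hU : ∑ i, ∑ j, ∑ k, (⟪F (e i) (e j) (e k), G (e i) (e j) (D (e k))⟫_ℝ
      + ⟪F (e i) (e j) (D (e k)), G (e i) (e j) (e k)⟫_ℝ) = 0 :=
    Finset.sum_eq_zero fun i _ => Finset.sum_eq_zero fun j _ =>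
      hs (B (F (e i) (e j)) (G (e i) (e j)))
  have hY : ∑ i, ∑ j, ∑ k, (⟪F (e i) (e j) (e k), G (e i) (D (e j)) (e k)⟫_ℝ
      + ⟪F (e i) (D (e j)) (e k), G (e i) (e j) (e k)⟫_ℝ) = 0 := by
    refine Finset.sum_eq_zero fun i _ => ?_
    rw [Finset.sum_comm]
    exact Finset.sum_eq_zero fun k _ => hs (B ((F (e i)).flip (e k)) ((G (e i)).flip (e k)))
  have hX : ∑ i, ∑ j, ∑ k, (⟪F (e i) (e j) (e k), G (D (e i)) (e j) (e k)⟫_ℝ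
      + ⟪F (D (e i)) (e j) (e k), G (e i) (e j) (e k)⟫_ℝ) = 0 := by
    rw [Finset.sum_comm]
    refine Finset.sum_eq_zero fun j _ => ?_
    rw [Finset.sum_comm]
    exact Finset.sum_eq_zero fun k _ =>
      hs (B ((F.flip (e j)).flip (e k)) ((G.flip (e j)).flip (e k)))
  simp only [inner_sub_left, inner_sub_right, hD (F _ _ _)]
  simp only [Finset.sum_add_distrib, Finset.sum_sub_distrib, Finset.sum_neg_distrib] at hX hY hU ⊢
  linarith

theorem eq_zero_of_tensorInner_self {V : Submodule ℝ T} {F : T →ₗ[ℝ] T →ₗ[ℝ] Module.End ℝ T}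
    (h : tensorInner V (fun X Y U => F X Y U) (fun X Y U => F X Y U) = 0) {X Y U : T} (hX : X ∈ V)
    (hY : Y ∈ V) (hU : U ∈ V) : F X Y U = 0 := by
  unfold tensorInner at h
  set e := stdOrthonormalBasis ℝ V
  have h0 : ∀ i j k, F (e i) (e j) (e k) = 0 := by
    intro i j k
    rw [Finset.sum_eq_zero_iff_of_nonneg fun i _ => Finset.sum_nonneg fun j _ =>
      Finset.sum_nonneg fun k _ => real_inner_self_nonneg] at h
    have h1 := h i (Finset.mem_univ i)
    rw [Finset.sum_eq_zero_iff_of_nonneg fun j _ =>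
      Finset.sum_nonneg fun k _ => real_inner_self_nonneg] at h1
    have h2 := h1 j (Finset.mem_univ j)
    rw [Finset.sum_eq_zero_iff_of_nonneg fun k _ => real_inner_self_nonneg] at h2
    exact inner_self_eq_zero.1 (h2 k (Finset.mem_univ k))
  have hsp : ∀ x ∈ V, ∃ c : _ → ℝ, x = ∑ i, c i • (e i : T) := by
    intro x hx
    refine ⟨fun i => ⟪e i, ⟨x, hx⟩⟫_ℝ, ?_⟩
    have h' := congrArg (Submodule.subtype V) (e.sum_repr' ⟨x, hx⟩)
    simp only [map_sum, map_smul, Submodule.subtype_apply] at h'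
    exact h'.symm
  obtain ⟨a, rfl⟩ := hsp X hX
  obtain ⟨b, rfl⟩ := hsp Y hY
  obtain ⟨c, rfl⟩ := hsp U hU
  simp [h0]

theorem tensorInner_smul_left (V : Submodule ℝ T) (c : ℝ) (F G : T → T → T → T) :
    tensorInner V (fun X Y U => c • F X Y U) G = c * tensorInner V F G := by
  simp only [tensorInner, inner_smul_left, Finset.mul_sum, RCLike.conj_to_real]

theorem tensorInner_comm (V : Submodule ℝ T) (F G : T → T → T → T) :
    tensorInner V F G = tensorInner V G F := by
  simp only [tensorInner, real_inner_comm]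

theorem tensorInner_congr {V : Submodule ℝ T} {F F' G G' : T → T → T → T}
    (hF : ∀ X ∈ V, ∀ Y ∈ V, ∀ U ∈ V, F X Y U = F' X Y U)
    (hG : ∀ X ∈ V, ∀ Y ∈ V, ∀ U ∈ V, G X Y U = G' X Y U) :
    tensorInner V F G = tensorInner V F' G' := by
  unfold tensorInner
  refine Finset.sum_congr rfl fun i _ => Finset.sum_congr rfl fun j _ =>
    Finset.sum_congr rfl fun k _ => ?_
  rw [hF _ (Subtype.prop _) _ (Subtype.prop _) _ (Subtype.prop _),
    hG _ (Subtype.prop _) _ (Subtype.prop _) _ (Subtype.prop _)]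

/-- If the derivative of `F` along a skew-symmetric operator is an eigentensor of the derivation, it
vanishes. -/
theorem derivAlong_eq_zero {V : Submodule ℝ T} {D : Module.End ℝ T} (hDV : ∀ x ∈ V, D x ∈ V)
    (hD : ∀ x y, ⟪D x, y⟫_ℝ = -⟪x, D y⟫_ℝ) {F G : T →ₗ[ℝ] T →ₗ[ℝ] Module.End ℝ T} {c : ℝ}
    (hF : ∀ X ∈ V, ∀ Y ∈ V, ∀ U ∈ V, derivAlong D F X Y U = G X Y U)
    (hG : ∀ X ∈ V, ∀ Y ∈ V, ∀ U ∈ V, derivAlong D G X Y U = c • G X Y U) {X Y U : T} (hX : X ∈ V)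
    (hY : Y ∈ V) (hU : U ∈ V) : G X Y U = 0 := by
  refine eq_zero_of_tensorInner_self ?_ hX hY hU
  -- Skewness gives `|G|² + c⟨G, F⟩ = 0` from the pair `G, F`, and `⟨F, G⟩ = ⟨F, D·F⟩ = 0` from the
  -- pair `F, F`.
  have h1 := tensorInner_derivAlong V D hDV hD G F
  have h2 := tensorInner_derivAlong V D hDV hD F F
  rw [tensorInner_congr (fun _ _ _ _ _ _ => rfl) hF,
    tensorInner_congr hG (fun _ _ _ _ _ _ => rfl), tensorInner_smul_left] at h1
  rw [tensorInner_congr (fun _ _ _ _ _ _ => rfl) hF,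
    tensorInner_congr hF (fun _ _ _ _ _ _ => rfl), tensorInner_comm] at h2
  have h3 : tensorInner V (fun X Y U => G X Y U) (fun X Y U => F X Y U) = 0 := by linarith
  rw [h3] at h1
  linarith

/-- The square of a skew-symmetric operator has nonpositive trace. -/
theorem trace_sq_nonpos_of_skew {V : Type*} [AddCommGroup V] [Module ℝ V] [FiniteDimensional ℝ V]
    (β : V →ₗ[ℝ] V →ₗ[ℝ] ℝ) (hsymm : ∀ x y, β x y = β y x) (hpos : ∀ x, x ≠ 0 → 0 < β x x)
    (D : Module.End ℝ V) (hD : ∀ x y, β (D x) y = -β x (D y)) :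
    LinearMap.trace ℝ V (D * D) ≤ 0 := by
  let core : InnerProductSpace.Core ℝ V :=
    { inner := fun x y => β x y
      conj_inner_symm := fun x y => hsymm y x
      re_inner_nonneg := fun x => by
        by_cases hx : x = 0
        · simp [hx]
        · exact (hpos x hx).le
      add_left := fun x y z => by simp
      smul_left := fun x y r => by simp
      definite := fun x hx => by
        by_contra h
        exact (hpos x h).ne' hx }
  let _ : NormedAddCommGroup V := core.toNormedAddCommGroup
  let _ : InnerProductSpace ℝ V := InnerProductSpace.ofCore core.toCore
  rw [LinearMap.trace_eq_sum_inner _ (stdOrthonormalBasis ℝ V)]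
  refine Finset.sum_nonpos fun i _ => ?_
  have h : ∀ x y : V, ⟪x, y⟫_ℝ = β x y := fun _ _ => rfl
  rw [Module.End.mul_apply, h, ← neg_neg (β _ _), ← hD, ← h]
  exact neg_nonpos.2 real_inner_self_nonneg

theorem trace_sq_of_skew (D : Module.End ℝ T) (hD : ∀ x y, ⟪D x, y⟫_ℝ = -⟪x, D y⟫_ℝ) :
    LinearMap.trace ℝ T (D * D) ≤ 0 :=
  trace_sq_nonpos_of_skew (innerₗ T) (fun x y => real_inner_comm y x)
    (fun _ hx => real_inner_self_pos.2 hx) D hD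

theorem eq_zero_of_trace_sq_of_skew {D : Module.End ℝ T} (hD : ∀ x y, ⟪D x, y⟫_ℝ = -⟪x, D y⟫_ℝ)
    (h : LinearMap.trace ℝ T (D * D) = 0) : D = 0 := by
  rw [LinearMap.trace_eq_sum_inner _ (stdOrthonormalBasis ℝ T)] at h
  have h' : ∑ i, ⟪D (stdOrthonormalBasis ℝ T i), D (stdOrthonormalBasis ℝ T i)⟫_ℝ = 0 := by
    rw [← neg_eq_zero, ← Finset.sum_neg_distrib, ← h]
    refine Finset.sum_congr rfl fun i _ => ?_
    rw [hD, neg_neg, Module.End.mul_apply]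
  rw [Finset.sum_eq_zero_iff_of_nonneg fun i _ => real_inner_self_nonneg] at h'
  exact (stdOrthonormalBasis ℝ T).toBasis.ext fun i => by
    simpa using h' i (Finset.mem_univ i)

end LinearAlgebra

/-! ### Ricci operator, Einstein factors, and derivations of the curvature. -/

namespace RiemannianSymmetricAlgebra

variable {𝔤 T : Type*} [LieRing 𝔤] [LieAlgebra ℝ 𝔤] [NormedAddCommGroup T] [InnerProductSpace ℝ T]
  [FiniteDimensional ℝ T] (S : RiemannianSymmetricAlgebra 𝔤 T)

theorem inner_ricci (X Y : T) :
    ⟪S.ricci X, Y⟫_ℝ = LinearMap.trace ℝ T ((S.curvature.flip Y).flip X) := by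
  rw [LinearMap.trace_eq_sum_inner _ (stdOrthonormalBasis ℝ T)]
  simp only [ricci, LinearMap.sum_apply, LinearMap.flip_apply, sum_inner]
  refine Finset.sum_congr rfl fun i _ => ?_
  rw [S.curvature_pair, real_inner_comm]

theorem ricci_apply (X : T) : S.ricci X = ∑ i,
    S.curvature X (stdOrthonormalBasis ℝ T i) (stdOrthonormalBasis ℝ T i) := by
  simp [ricci, LinearMap.sum_apply]

theorem ricci_isSymmetric : S.ricci.IsSymmetric := by
  intro X Y
  simp only [ricci_apply, sum_inner, inner_sum]
  refine Finset.sum_congr rfl fun i _ => ?_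
  rw [S.curvature_pair, S.inner_curvature, S.curvature_swap]
  simp

/-- Invariance of `R` under `R(U, V)` turns the difference into the trace of a commutator. -/
theorem ricci_curvature (U V X : T) :
    S.ricci (S.curvature U V X) = S.curvature U V (S.ricci X) := by
  refine ext_inner_right ℝ fun Y => ?_
  rw [S.inner_curvature U V (S.ricci X), S.inner_ricci, S.inner_ricci, ← sub_eq_zero,
    sub_neg_eq_add, ← map_add]
  have h : (S.curvature.flip Y).flip (S.curvature U V X)
      + (S.curvature.flip (S.curvature U V Y)).flip X
      = S.curvature U V * (S.curvature.flip Y).flip X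
        - (S.curvature.flip Y).flip X * S.curvature U V := by
    ext Z
    simp only [LinearMap.add_apply, LinearMap.sub_apply, Module.End.mul_apply, LinearMap.flip_apply]
    rw [S.curvature_curvature U V Z Y X]
    abel
  rw [h, map_sub, LinearMap.trace_mul_comm, sub_self]

variable {S}

theorem IsHolonomyInvariant.ricci_mem {W : Submodule ℝ T} (hW : S.IsHolonomyInvariant W) {X : T}
    (hX : X ∈ W) : S.ricci X ∈ W := by
  rw [← W.orthogonal_orthogonal, Submodule.mem_orthogonal]
  intro Y hY
  rw [ricci_apply, inner_sum]
  refine Finset.sum_eq_zero fun i _ => ?_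
  rw [real_inner_comm, S.inner_curvature, hW.curvature_apply_eq_zero hX hY]
  simp

/-- Irreducible factors are Einstein. -/
theorem exists_ricci_eq_smul {W : Submodule ℝ T} (hW : S.IsHolonomyInvariant W) (hne : W ≠ ⊥)
    (hirr : ∀ W' ≤ W, S.IsHolonomyInvariant W' → W' = ⊥ ∨ W' = W) :
    ∃ c : ℝ, ∀ X ∈ W, S.ricci X = c • X := by
  have hinv : ∀ X ∈ W, S.ricci X ∈ W := fun X hX => hW.ricci_mem hX
  have hsymm := S.ricci_isSymmetric.restrict_invariant hinv
  have : Nontrivial W := (Submodule.nontrivial_iff_ne_bot).2 hne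
  obtain ⟨c, hc⟩ : ∃ c : ℝ, Module.End.HasEigenvalue (S.ricci.restrict hinv) c :=
    ⟨_, hsymm.hasEigenvalue_iSup_of_finiteDimensional⟩
  obtain ⟨v, hv⟩ := hc.exists_hasEigenvector
  have hv1 := congrArg (Submodule.subtype W) hv.apply_eq_smul
  simp only [Submodule.subtype_apply, LinearMap.coe_restrict_apply, Submodule.coe_smul] at hv1
  -- An eigenspace of the Ricci operator in `W` is holonomy-invariant, since the Ricci operator
  -- commutes with `R(U, V)`.
  let W' : Submodule ℝ T := W ⊓ LinearMap.ker (S.ricci - c • 1)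
  have hmem : ∀ X, X ∈ W' ↔ X ∈ W ∧ S.ricci X = c • X := by
    intro X
    simp [W', sub_eq_zero]
  have hW' : S.IsHolonomyInvariant W' := by
    intro U V X hX
    rw [hmem] at hX ⊢
    exact ⟨hW _ _ _ hX.1, by rw [ricci_curvature, hX.2, map_smul]⟩
  refine ⟨c, fun X hX => ?_⟩
  rcases hirr W' inf_le_left hW' with h0 | h1
  · have hvW' : (v : T) ∈ W' := (hmem _).2 ⟨v.2, hv1⟩
    rw [h0, Submodule.mem_bot] at hvW'
    exact absurd (Subtype.ext hvW') hv.2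
  · rw [← h1, hmem] at hX
    exact hX.2

/-- A factor on which the Ricci operator vanishes is flat. -/
theorem curvature_eq_zero_of_ricci {W : Submodule ℝ T} (h : ∀ X ∈ W, S.ricci X = 0) {X Y : T}
    (hX : X ∈ W) (hY : Y ∈ W) : S.curvature X Y = 0 := by
  have : FiniteDimensional ℝ S.𝔥 := Module.Finite.of_injective S.ad S.ad_injective
  set c := S.bracket X Y with hc
  -- These traces are Ricci components with an argument in `W`. Without them, the traces of `ad_c²`
  -- on `𝔥` and on `𝔪` are opposite, that is, the Killing form of `𝔤` vanishes at `c`. Both traces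
  -- are nonpositive, so both are zero and `c` acts trivially.
  have hr : ∀ Z, ∀ Y ∈ W, LinearMap.trace ℝ T (S.ad.flip Z ∘ₗ S.bracket Y) = 0 := by
    intro Z Y hY
    have h1 : S.ad.flip Z ∘ₗ S.bracket Y = (S.curvature.flip Y).flip Z := by
      ext V
      simp only [LinearMap.comp_apply, LinearMap.flip_apply, ad_bracket, LinearMap.neg_apply]
      rw [S.curvature_swap]
      simp
    rw [h1, ← inner_ricci, S.ricci_isSymmetric, h Y hY, inner_zero_right]
  have hadT : S.ad c = S.ad.flip Y ∘ₗ S.bracket X - S.ad.flip X ∘ₗ S.bracket Y := by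
    ext V
    simp only [hc, ad_bracket, LinearMap.sub_apply, LinearMap.comp_apply, LinearMap.flip_apply,
      LinearMap.neg_apply]
    have h1 := S.curvature_bianchi X Y V
    rw [S.curvature_swap V X, LinearMap.neg_apply] at h1
    linear_combination (norm := module) (-1 : ℝ) • h1
  have hadH : (LieAlgebra.ad ℝ S.𝔥 c : Module.End ℝ S.𝔥)
      = S.bracket Y ∘ₗ S.ad.flip X - S.bracket X ∘ₗ S.ad.flip Y := by
    ext1 A
    simp only [LieAlgebra.ad_apply, LinearMap.sub_apply, LinearMap.comp_apply, LinearMap.flip_apply]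
    rw [← lie_skew, hc, ad_ad_bracket]
    have : S.bracket (S.ad A X) Y = -S.bracket Y (S.ad A X) := by
      ext
      simp [coe_bracket]
    rw [this]
    abel
  have hcomm : ∀ Z, S.ad.flip Z ∘ₗ (LieAlgebra.ad ℝ S.𝔥 c : Module.End ℝ S.𝔥)
      = S.ad c ∘ₗ S.ad.flip Z - S.ad.flip (S.ad c Z) := by
    intro Z
    ext1 A
    simp [ad_lie, LieRing.of_associative_ring_bracket]
  have hH : LinearMap.trace ℝ S.𝔥 (LieAlgebra.ad ℝ S.𝔥 c * LieAlgebra.ad ℝ S.𝔥 c)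
      = LinearMap.trace ℝ T (S.ad c ∘ₗ S.ad.flip X ∘ₗ S.bracket Y)
        - LinearMap.trace ℝ T (S.ad c ∘ₗ S.ad.flip Y ∘ₗ S.bracket X) := by
    nth_rewrite 1 [hadH]
    rw [sub_mul, map_sub, Module.End.mul_eq_comp, Module.End.mul_eq_comp, LinearMap.comp_assoc,
      LinearMap.comp_assoc, hcomm, hcomm, LinearMap.trace_comp_comm' _ (S.bracket Y),
      LinearMap.trace_comp_comm' _ (S.bracket X), LinearMap.sub_comp, LinearMap.sub_comp, map_sub,
      map_sub, hr _ X hX, hr _ Y hY, sub_zero, sub_zero, LinearMap.comp_assoc, LinearMap.comp_assoc]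
  have hT : LinearMap.trace ℝ T (S.ad c * S.ad c)
      = LinearMap.trace ℝ T (S.ad c ∘ₗ S.ad.flip Y ∘ₗ S.bracket X)
        - LinearMap.trace ℝ T (S.ad c ∘ₗ S.ad.flip X ∘ₗ S.bracket Y) := by
    nth_rewrite 2 [hadT]
    rw [mul_sub, map_sub]
    rfl
  have hTn := trace_sq_of_skew (S.ad c) (S.inner_ad c)
  -- On `𝔥` the invariant inner product is `-tr(ad_A ad_B)`, positive definite by effectiveness.
  have hHn : LinearMap.trace ℝ S.𝔥 (LieAlgebra.ad ℝ S.𝔥 c * LieAlgebra.ad ℝ S.𝔥 c) ≤ 0 := by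
    refine trace_sq_nonpos_of_skew
      (-(((LinearMap.mul ℝ (Module.End ℝ T)).compr₂ (LinearMap.trace ℝ T)).compl₁₂ S.ad S.ad))
      ?_ ?_ _ ?_
    · intro A B
      simp [LinearMap.trace_mul_comm ℝ (S.ad A)]
    · intro A hA
      have h1 := trace_sq_of_skew (S.ad A) (S.inner_ad A)
      simp only [LinearMap.neg_apply, LinearMap.compl₁₂_apply, LinearMap.compr₂_apply,
        LinearMap.mul_apply', Left.neg_pos_iff]
      refine h1.lt_of_ne fun h2 => hA (S.effective A ?_)
      have h3 := S.ad_injective ((eq_zero_of_trace_sq_of_skew (S.inner_ad A) h2).trans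
        (map_zero S.ad).symm)
      rw [h3, map_zero]
    · intro A B
      simp only [LinearMap.neg_apply, LinearMap.compl₁₂_apply, LinearMap.compr₂_apply,
        LinearMap.mul_apply', LieAlgebra.ad_apply, ad_lie, LieRing.of_associative_ring_bracket]
      rw [sub_mul, mul_sub, map_sub, map_sub, mul_assoc, LinearMap.trace_mul_comm ℝ (S.ad c),
        mul_assoc, mul_assoc]
      ring
  have h0 := eq_zero_of_trace_sq_of_skew (S.inner_ad c) (by linarith)
  rw [hc, ad_bracket, neg_eq_zero] at h0
  exact h0

omit [FiniteDimensional ℝ T] in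
theorem mem_of_mem_factorIsotropy {W : Submodule ℝ T} (hW : S.IsHolonomyInvariant W) {A : S.𝔥}
    (hA : A ∈ S.factorIsotropy W) {X : T} (hX : X ∈ W) : S.ad A X ∈ W := by
  induction hA using Submodule.span_induction with
  | mem A h =>
    obtain ⟨U, _, V, _, rfl⟩ := h
    rw [ad_bracket]
    exact W.neg_mem (hW _ _ _ hX)
  | zero => simp
  | add A B _ _ hA hB => simpa using W.add_mem hA hB
  | smul c A _ hA => simpa using W.smul_mem c hA

/-- Skew-symmetric derivations of the curvature tensor of an irreducible factor of nonconstant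
curvature belong to its isotropy algebra. -/
theorem exists_ad_eq_of_derivation {W : Submodule ℝ T} (hW : S.IsHolonomyInvariant W)
    (hirr : ∀ W' ≤ W, S.IsHolonomyInvariant W' → W' = ⊥ ∨ W' = W)
    (hcurv : ¬ S.HasConstantCurvature W) (D : Module.End ℝ T)
    (hD : ∀ X Y, ⟪D X, Y⟫_ℝ = -⟪X, D Y⟫_ℝ) (hDW : ∀ X ∈ W, D X ∈ W)
    (hder : ∀ X ∈ W, ∀ Y ∈ W,
      D * S.curvature X Y - S.curvature X Y * D = S.curvature (D X) Y + S.curvature X (D Y)) :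
    ∃ A ∈ S.factorIsotropy W, ∀ X ∈ W, D X = S.ad A X := by
  have hne : W ≠ ⊥ := by
    rintro rfl
    refine hcurv ⟨0, fun X hX Y hY Z _ => ?_⟩
    rw [Submodule.mem_bot] at hX
    simp [hX]
  obtain ⟨c, hc⟩ := exists_ricci_eq_smul hW hne hirr
  -- A Ricci-flat factor would be flat, hence of constant curvature.
  have hc0 : c ≠ 0 := by
    rintro rfl
    refine hcurv ⟨0, fun X hX Y hY Z _ => ?_⟩
    rw [curvature_eq_zero_of_ricci (fun X hX => by rw [hc X hX, zero_smul]) hX hY]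
    simp
  let B : LinearMap.BilinForm ℝ (Module.End ℝ T) :=
    (LinearMap.mul ℝ (Module.End ℝ T)).compr₂ (LinearMap.trace ℝ T)
  have hB : ∀ a b, B a b = LinearMap.trace ℝ T (a * b) := fun _ _ => rfl
  set 𝔞 : Submodule ℝ (Module.End ℝ T) := (S.factorIsotropy W).map S.ad
  have hdef : ∀ a ∈ 𝔞, B a a = 0 → a = 0 := by
    rintro _ ⟨A, _, rfl⟩ h
    exact eq_zero_of_trace_sq_of_skew (S.inner_ad A) h
  have hsymm : B.IsSymm := ⟨fun a b => LinearMap.trace_mul_comm ℝ a b⟩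
  have hcompl : IsCompl 𝔞 (B.orthogonal 𝔞) := by
    rw [LinearMap.BilinForm.isCompl_orthogonal_iff_disjoint hsymm.isRefl, Submodule.disjoint_def]
    exact fun a ha ha' => hdef a ha (ha' a ha)
  -- The trace form is definite on `𝔞`, so `D` splits into an element of `𝔞` and `E` orthogonal to
  -- `𝔞`; it remains to show `E = 0` on `W`.
  obtain ⟨D₁, E, hD₁, hE, hDE⟩ := Submodule.codisjoint_iff_exists_add_eq.1 hcompl.codisjoint D
  obtain ⟨A, hA, rfl⟩ := hD₁
  refine ⟨A, hA, fun X hX => ?_⟩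
  have hEeq : E = D - S.ad A := eq_sub_of_add_eq' hDE
  have hEskew : ∀ X Y, ⟪E X, Y⟫_ℝ = -⟪X, E Y⟫_ℝ := by
    intro X Y
    rw [hEeq, LinearMap.sub_apply, LinearMap.sub_apply, inner_sub_left, inner_sub_right, hD,
      S.inner_ad]
    ring
  have hEW : ∀ X ∈ W, E X ∈ W := by
    intro X hX
    rw [hEeq]
    exact W.sub_mem (hDW X hX) (mem_of_mem_factorIsotropy hW hA hX)
  have hEder : ∀ X ∈ W, ∀ Y ∈ W,
      E * S.curvature X Y - S.curvature X Y * E = S.curvature (E X) Y + S.curvature X (E Y) := by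
    intro X hX Y hY
    have h1 : S.ad A * S.curvature X Y - S.curvature X Y * S.ad A
        = S.curvature (S.ad A X) Y + S.curvature X (S.ad A Y) := by
      ext Z
      simp [ad_curvature]
    have h2 := hder X hX Y hY
    rw [hEeq, sub_mul, mul_sub, LinearMap.sub_apply, LinearMap.sub_apply, map_sub, map_sub,
      LinearMap.sub_apply]
    linear_combination (norm := module) h2 - h1
  have hmem : ∀ X ∈ W, ∀ Y ∈ W, S.curvature X Y ∈ 𝔞 := by
    intro X hX Y hY
    refine ⟨-S.bracket X Y, neg_mem (Submodule.subset_span ⟨X, hX, Y, hY, rfl⟩), ?_⟩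
    rw [map_neg, ad_bracket, neg_neg]
  have hlie : ∀ F : Module.End ℝ T, (∀ X ∈ W, F X ∈ W) → (∀ X ∈ W, ∀ Y ∈ W,
      F * S.curvature X Y - S.curvature X Y * F = S.curvature (F X) Y + S.curvature X (F Y)) →
      ∀ b ∈ 𝔞, F * b - b * F ∈ 𝔞 := by
    rintro F hF1 hF2 _ ⟨C, hC, rfl⟩
    induction hC using Submodule.span_induction with
    | mem C h =>
      obtain ⟨X, hX, Y, hY, rfl⟩ := h
      rw [ad_bracket, mul_neg, neg_mul, neg_sub_neg, ← neg_sub, hF2 X hX Y hY]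
      exact neg_mem (add_mem (hmem _ (hF1 X hX) Y hY) (hmem X hX _ (hF1 Y hY)))
    | zero => simp
    | add A B _ _ hA hB =>
      rw [map_add, mul_add, add_mul, add_sub_add_comm]
      exact add_mem hA hB
    | smul c A _ hA =>
      rw [map_smul, mul_smul_comm, smul_mul_assoc, ← smul_sub]
      exact 𝔞.smul_mem c hA
  have hlie𝔞 : ∀ a ∈ 𝔞, ∀ b ∈ 𝔞, a * b - b * a ∈ 𝔞 := by
    rintro _ ⟨C, hC, rfl⟩
    refine hlie _ (fun X hX => mem_of_mem_factorIsotropy hW hC hX) fun X _ Y _ => ?_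
    ext Z
    simp [ad_curvature]
  have hEorth : ∀ a ∈ 𝔞, LinearMap.trace ℝ T (E * a) = 0 := by
    intro a ha
    rw [LinearMap.trace_mul_comm]
    exact hE a ha
  -- With `d = [E, b] ∈ 𝔞`, invariance of the trace form gives `tr(d d) = tr(E [b, d]) = 0`, because
  -- `[b, d] ∈ 𝔞`.
  have hEcomm : ∀ b ∈ 𝔞, E * b - b * E = 0 := by
    intro b hb
    have h1 := hlie E hEW hEder b hb
    refine hdef _ h1 ?_
    rw [hB, ← hEorth _ (hlie𝔞 b hb _ h1)]
    generalize hd : E * b - b * E = d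
    nth_rewrite 1 [← hd]
    rw [sub_mul, mul_sub, map_sub, map_sub, mul_assoc, mul_assoc, LinearMap.trace_mul_comm ℝ b,
      mul_assoc]
  have hEX : ∀ X ∈ W, ∀ Y ∈ W, E * (S.curvature.flip Y).flip X
      = (S.curvature.flip Y).flip (E X) := by
    intro X hX Y hY
    ext V
    simp only [Module.End.mul_apply, LinearMap.flip_apply]
    obtain ⟨V₁, hV₁, V₂, hV₂, rfl⟩ := W.exists_add_mem_mem_orthogonal V
    have h1 := LinearMap.congr_fun (hEcomm _ (hmem V₁ hV₁ Y hY)) X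
    simp only [LinearMap.sub_apply, Module.End.mul_apply,
      LinearMap.zero_apply] at h1
    simp [hW.curvature_eq_zero' hV₂ hY, sub_eq_zero.1 h1]
  -- By the Bianchi identity, `0 = tr(E R(X, Y)) = ⟨Ric EX, Y⟩ - ⟨Ric EY, X⟩ = 2c⟨EX, Y⟩`.
  have hricci : ∀ X ∈ W, ∀ Y ∈ W, ⟪E X, Y⟫_ℝ = 0 := by
    intro X hX Y hY
    have h1 : S.curvature X Y
        = (S.curvature.flip Y).flip X - (S.curvature.flip X).flip Y := by
      ext V
      simp only [LinearMap.sub_apply, LinearMap.flip_apply]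
      have h1 := S.curvature_bianchi X Y V
      rw [S.curvature_swap Y V, LinearMap.neg_apply] at h1
      linear_combination (norm := module) h1
    have h2 := hEorth _ (hmem X hX Y hY)
    rw [h1, mul_sub, hEX X hX Y hY, hEX Y hY X hX, map_sub, ← inner_ricci, ← inner_ricci,
      hc _ (hEW X hX), hc _ (hEW Y hY), inner_smul_left, inner_smul_left, hEskew Y X,
      real_inner_comm (E X) Y] at h2
    simp only [RCLike.conj_to_real] at h2
    have h3 : c * ⟪E X, Y⟫_ℝ = 0 := by linarith
    exact (mul_eq_zero.1 h3).resolve_left hc0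
  have h0 : E X = 0 := inner_self_eq_zero.1 (hricci X hX _ (hEW X hX))
  rw [← hDE, LinearMap.add_apply, h0, add_zero]

end RiemannianSymmetricAlgebra

/-- `(X, Y) ↦ X ∧ Y` as a bilinear map. -/
def wedgeₗ (T : Type*) [NormedAddCommGroup T] [InnerProductSpace ℝ T] :
    T →ₗ[ℝ] T →ₗ[ℝ] Module.End ℝ T :=
  LinearMap.mk₂ ℝ wedgeOp
    (fun X X' Y => by ext U; simp [wedgeOp]; module)
    (fun c X Y => by ext U; simp [wedgeOp]; module)
    (fun X Y Y' => by ext U; simp [wedgeOp]; module)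
    (fun c X Y => by ext U; simp [wedgeOp]; module)

theorem wedgeₗ_apply {T : Type*} [NormedAddCommGroup T] [InnerProductSpace ℝ T] (X Y U : T) :
    wedgeₗ T X Y U = ⟪X, U⟫_ℝ • Y - ⟪Y, U⟫_ℝ • X := by
  simp [wedgeₗ, wedgeOp]

theorem derivAlong_wedgeₗ {T : Type*} [NormedAddCommGroup T] [InnerProductSpace ℝ T]
    {D : Module.End ℝ T} (hD : ∀ x y, ⟪D x, y⟫_ℝ = -⟪x, D y⟫_ℝ) (X Y U : T) :
    derivAlong D (wedgeₗ T) X Y U = 0 := by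
  simp only [derivAlong, wedgeₗ_apply, hD, map_sub, map_smul]
  module

/-! ### Vanishing of the components of `K` and `Q` that mix a factor with its complement. -/

namespace RiemannianSymmetricAlgebra

variable {𝔤 T : Type*} [LieRing 𝔤] [LieAlgebra ℝ 𝔤] [NormedAddCommGroup T] [InnerProductSpace ℝ T]
  (S : RiemannianSymmetricAlgebra 𝔤 T)

/-- The differential Bianchi identity for the pair `(K, Q)`, at the vector `U`. -/
def SatisfiesBianchi (K : T →ₗ[ℝ] Module.End ℝ T) (Q : T →ₗ[ℝ] T →ₗ[ℝ] T) : Prop :=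
  ∀ X Y Z U : T,
    (K Z (S.curvature X Y U) - S.curvature X Y (K Z U) - S.curvature (K X Y - K Y X) Z U
        + ⟪Q X Y, U⟫_ℝ • Z - ⟪Z, U⟫_ℝ • Q X Y)
      + (K X (S.curvature Y Z U) - S.curvature Y Z (K X U) - S.curvature (K Y Z - K Z Y) X U
        + ⟪Q Y Z, U⟫_ℝ • X - ⟪X, U⟫_ℝ • Q Y Z)
      + (K Y (S.curvature Z X U) - S.curvature Z X (K Y U) - S.curvature (K Z X - K X Z) Y U
        + ⟪Q Z X, U⟫_ℝ • Y - ⟪Y, U⟫_ℝ • Q Z X) = 0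

variable {S} {K : T →ₗ[ℝ] Module.End ℝ T} {Q : T →ₗ[ℝ] T →ₗ[ℝ] T} [FiniteDimensional ℝ T]

/-- The `W`-component of the identity: every curvature term mixing `W` and `Wᗮ` drops out, except
the one through the `W`-part of `K_Y U`. -/
theorem SatisfiesBianchi.curvature_starProjection (hB : S.SatisfiesBianchi K Q)
    (hQ : ∀ X Y, Q X Y = -Q Y X) {W : Submodule ℝ T} (hW : S.IsHolonomyInvariant W) {X Y Z U : T}
    (hX : X ∈ W) (hZ : Z ∈ W) (hY : Y ∈ Wᗮ) (hU : U ∈ Wᗮ) :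
    S.curvature Z X (W.starProjection (K Y U))
      = ⟪Q Y Z, U⟫_ℝ • X - ⟪Q Y X, U⟫_ℝ • Z - ⟪Y, U⟫_ℝ • W.starProjection (Q Z X) := by
  have h := hB X Y Z U
  have hp : S.curvature Z X (K Y U) = S.curvature Z X (W.starProjection (K Y U)) := by
    rw [← sub_eq_zero, ← map_sub]
    exact hW.curvature_apply_eq_zero hZ (W.sub_starProjection_mem_orthogonal _) X
  have hr : ∀ V, W.starProjection (S.curvature V Y U) = 0 := fun V =>
    (W.starProjection_apply_eq_zero_iff).2 (hW.orthogonal _ _ _ hU)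
  have hY0 : W.starProjection Y = 0 := (W.starProjection_apply_eq_zero_iff).2 hY
  rw [hW.curvature_eq_zero hX hY, hW.curvature_eq_zero' hY hZ,
    hW.curvature_apply_eq_zero' hZ hU, hW.curvature_apply_eq_zero' hX hU,
    hW.curvature_apply_eq_zero hZ hU, Submodule.inner_right_of_mem_orthogonal hZ hU,
    Submodule.inner_right_of_mem_orthogonal hX hU, hp, hQ X Y] at h
  have h1 := congrArg W.starProjection h
  simp only [LinearMap.zero_apply, map_zero, map_add, map_sub, map_smul, LinearMap.sub_apply, hr, hY0,
    W.starProjection_eq_self_iff.2 hX, W.starProjection_eq_self_iff.2 hZ,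
    W.starProjection_eq_self_iff.2 (hW Z X _ (W.starProjection_apply_mem (K Y U))),
    inner_neg_left] at h1
  linear_combination (norm := module) (-1 : ℝ) • h1

/-- For `Y ⟂ U` the last term of `curvature_starProjection` disappears and
`eq_zero_of_curvature_apply_eq` applies; bilinear maps vanishing on orthogonal pairs are multiples
of the metric. -/
theorem SatisfiesBianchi.exists_eq_inner_mul (hB : S.SatisfiesBianchi K Q)
    (hQ : ∀ X Y, Q X Y = -Q Y X) {W : Submodule ℝ T} (hW : S.IsHolonomyInvariant W)
    (hirr : ∀ W' ≤ W, S.IsHolonomyInvariant W' → W' = ⊥ ∨ W' = W)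
    (hcurv : ¬ S.HasConstantCurvature W) :
    ∃ (w : T) (f : T →ₗ[ℝ] ℝ),
      (∀ Y ∈ Wᗮ, ∀ U ∈ Wᗮ, ∀ Z ∈ W, ⟪K Y U, Z⟫_ℝ = ⟪Y, U⟫_ℝ * ⟪w, Z⟫_ℝ) ∧
      (∀ Y ∈ Wᗮ, ∀ U ∈ Wᗮ, ∀ Z ∈ W, ⟪Q Y Z, U⟫_ℝ = ⟪Y, U⟫_ℝ * f Z) := by
  have key : ∀ Y ∈ Wᗮ, ∀ U ∈ Wᗮ, ⟪Y, U⟫_ℝ = 0 →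
      W.starProjection (K Y U) = 0 ∧ ∀ X ∈ W, ⟪Q Y X, U⟫_ℝ = 0 := by
    intro Y hY U hU hYU
    have := eq_zero_of_curvature_apply_eq hW hirr hcurv (innerₗ T U ∘ₗ Q Y)
      (W.starProjection_apply_mem (K Y U)) (fun Z hZ X hX => by
        rw [hB.curvature_starProjection hQ hW hX hZ hY hU, hYU, zero_smul, sub_zero]
        simp [real_inner_comm U])
    refine ⟨this.1, fun X hX => ?_⟩
    rw [real_inner_comm]
    exact this.2 X hX
  obtain ⟨w, hw⟩ := exists_eq_inner_smul Wᗮ (K.compr₂ (W.starProjection : T →ₗ[ℝ] T))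
    (fun Y hY U hU hYU => (key Y hY U hU hYU).1)
  let b : T →ₗ[ℝ] T →ₗ[ℝ] (T →ₗ[ℝ] ℝ) := LinearMap.mk₂ ℝ
    (fun Y U => innerₗ T U ∘ₗ Q Y ∘ₗ (W.starProjection : T →ₗ[ℝ] T))
    (fun _ _ _ => by ext; simp [inner_add_right]) (fun _ _ _ => by ext; simp)
    (fun _ _ _ => by ext; simp) (fun _ _ _ => by ext; simp)
  have hb : ∀ Y U X, b Y U X = ⟪U, Q Y (W.starProjection X)⟫_ℝ := fun _ _ _ => rfl
  obtain ⟨f, hf⟩ := exists_eq_inner_smul Wᗮ b (fun Y hY U hU hYU => by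
    ext X
    rw [hb, real_inner_comm]
    exact (key Y hY U hU hYU).2 _ (W.starProjection_apply_mem X))
  refine ⟨w, f, fun Y hY U hU Z hZ => ?_, fun Y hY U hU Z hZ => ?_⟩
  · have h1 : W.starProjection (K Y U) = ⟪Y, U⟫_ℝ • w := hw Y hY U hU
    rw [← real_inner_smul_left, ← h1, W.inner_starProjection_left_eq_right,
      W.starProjection_eq_self_iff.2 hZ]
  · have h1 := LinearMap.congr_fun (hf Y hY U hU) Z
    rw [hb, W.starProjection_eq_self_iff.2 hZ, real_inner_comm] at h1
    exact h1

/-- The eigentensor argument on `V = Wᗮ`, which need not be irreducible. -/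
theorem SatisfiesBianchi.coefficients_eq_zero (hB : S.SatisfiesBianchi K Q)
    (hQ : ∀ X Y, Q X Y = -Q Y X) (hK : ∀ Z X Y : T, ⟪K Z X, Y⟫_ℝ = -⟪X, K Z Y⟫_ℝ)
    {W : Submodule ℝ T} (hW : S.IsHolonomyInvariant W) (hcurv : ¬ S.HasConstantCurvature Wᗮ)
    {w : T} {f : T →ₗ[ℝ] ℝ}
    (hw : ∀ Y ∈ Wᗮ, ∀ U ∈ Wᗮ, ∀ Z ∈ W, ⟪K Y U, Z⟫_ℝ = ⟪Y, U⟫_ℝ * ⟪w, Z⟫_ℝ)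
    (hf : ∀ Y ∈ Wᗮ, ∀ U ∈ Wᗮ, ∀ Z ∈ W, ⟪Q Y Z, U⟫_ℝ = ⟪Y, U⟫_ℝ * f Z) {Z : T} (hZ : Z ∈ W) :
    ⟪w, Z⟫_ℝ = 0 ∧ f Z = 0 := by
  set V := Wᗮ
  have hVinv : S.IsHolonomyInvariant V := hW.orthogonal
  set p : T →ₗ[ℝ] T := (V.starProjection : T →ₗ[ℝ] T)
  have hpmem : ∀ x, p x ∈ V := V.starProjection_apply_mem
  have hpself : ∀ x ∈ V, p x = x := fun x hx => V.starProjection_eq_self_iff.2 hx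
  have hpsymm : ∀ x y, ⟪p x, y⟫_ℝ = ⟪x, p y⟫_ℝ := V.inner_starProjection_left_eq_right
  have hpsub : ∀ x, x - p x ∈ Vᗮ := V.sub_starProjection_mem_orthogonal
  have hpZ : p Z = 0 :=
    V.starProjection_apply_eq_zero_iff.2 (W.le_orthogonal_orthogonal hZ)
  have hpext : ∀ x, ∀ y ∈ V, (∀ u ∈ V, ⟪x, u⟫_ℝ = ⟪y, u⟫_ℝ) → p x = y := by
    intro x y hy h
    exact V.eq_starProjection_of_mem_of_inner_eq_zero hy fun u hu => by
      rw [inner_sub_left, h u hu, sub_self]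
  have hR₁ : ∀ x, ∀ Y ∈ V, ∀ U, S.curvature x Y U = S.curvature (p x) Y U := by
    intro x Y hY U
    rw [← sub_eq_zero, ← LinearMap.sub_apply, ← LinearMap.sub_apply, ← map_sub,
      hVinv.curvature_eq_zero' (hpsub x) hY, LinearMap.zero_apply]
  have hR₃ : ∀ X ∈ V, ∀ Y U, S.curvature X Y U = S.curvature X Y (p U) := by
    intro X hX Y U
    rw [← sub_eq_zero, ← map_sub]
    exact hVinv.curvature_apply_eq_zero hX (hpsub U) Y
  set D : Module.End ℝ T := p ∘ₗ K Z ∘ₗ p with hD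
  have hDV : ∀ x ∈ V, D x ∈ V := fun x _ => hpmem _
  have hDskew : ∀ x y, ⟪D x, y⟫_ℝ = -⟪x, D y⟫_ℝ := by
    intro x y
    simp only [hD, LinearMap.comp_apply]
    rw [hpsymm, hK, ← hpsymm]
  have hDp : ∀ x ∈ V, p (K Z x) = D x := by
    intro x hx
    simp only [hD, LinearMap.comp_apply, hpself x hx]
  have hpK : ∀ Y ∈ V, p (K Y Z) = -⟪w, Z⟫_ℝ • Y := by
    intro Y hY
    refine hpext _ _ (V.smul_mem _ hY) fun u hu => ?_
    rw [hK, real_inner_comm, hw Y hY u hu Z hZ, inner_smul_left]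
    simp
    ring
  have hpQ : ∀ Y ∈ V, p (Q Y Z) = f Z • Y := by
    intro Y hY
    refine hpext _ _ (V.smul_mem _ hY) fun u hu => ?_
    rw [hf Y hY u hu Z hZ, inner_smul_left]
    simp
    ring
  -- The factors 2 arise because two of the three cyclic terms contribute: `K_X Z` and `K_Y Z` to
  -- the first coefficient, `Q(X, Z)` and `Q(Y, Z)` to the second.
  set G : T →ₗ[ℝ] T →ₗ[ℝ] Module.End ℝ T :=
    (2 * ⟪w, Z⟫_ℝ) • S.curvature + (2 * f Z) • wedgeₗ T with hG
  have hGapply : ∀ X Y U, G X Y U = (2 * ⟪w, Z⟫_ℝ) • S.curvature X Y U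
      + (2 * f Z) • (⟪X, U⟫_ℝ • Y - ⟪Y, U⟫_ℝ • X) := by
    intro X Y U
    simp [hG, wedgeₗ_apply]
  have hder : ∀ X ∈ V, ∀ Y ∈ V, ∀ U ∈ V, derivAlong D S.curvature X Y U = G X Y U := by
    intro X hX Y hY U hU
    have h := congrArg p (hB X Y Z U)
    rw [hW.curvature_eq_zero' hY hZ, hW.curvature_eq_zero hZ hX,
      hW.curvature_apply_eq_zero' hZ hU, Submodule.inner_right_of_mem_orthogonal hZ hU,
      hR₁ (K Y Z - K Z Y) X hX, hR₁ (K Z X - K X Z) Y hY, hR₃ X hX Y (K Z U), hQ Z X, inner_neg_left, hf Y hY U hU Z hZ,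
      hf X hX U hU Z hZ] at h
    simp only [map_add, map_sub, map_smul, map_neg, LinearMap.zero_apply, map_zero,
      hpself _ hX, hpself _ hY, hpself _ (hVinv _ _ _ hU), hpself _ (hVinv X Y _ (hDV U hU)), hpZ,
      hpK X hX, hpK Y hY, hpQ X hX, hpQ Y hY, hDp X hX, hDp Y hY, hDp U hU,
      hDp _ (hVinv X Y U hU), LinearMap.sub_apply, LinearMap.neg_apply, LinearMap.smul_apply,
      neg_smul] at h
    rw [hGapply, derivAlong]
    rw [S.curvature_swap (D Y) X, S.curvature_swap Y X] at h
    simp only [LinearMap.neg_apply] at h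
    linear_combination (norm := module) h
  have hGder : ∀ X ∈ V, ∀ Y ∈ V, ∀ U ∈ V,
      derivAlong D G X Y U = (2 * ⟪w, Z⟫_ℝ) • G X Y U := by
    intro X hX Y hY U hU
    rw [← hder X hX Y hY U hU]
    have h1 := derivAlong_wedgeₗ hDskew X Y U
    simp only [derivAlong, hG, LinearMap.add_apply, LinearMap.smul_apply, map_add, map_smul] at h1 ⊢
    linear_combination (norm := module) (2 * f Z) • h1
  have hG0 := fun X hX Y hY U hU =>
    derivAlong_eq_zero (X := X) (Y := Y) (U := U) hDV hDskew hder hGder hX hY hU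
  have hw0 : ⟪w, Z⟫_ℝ = 0 := by
    by_contra hne
    -- If `⟨w, Z⟩ ≠ 0`, the equation `G = 0` solves for `R` on `V` as a constant curvature tensor.
    refine hcurv ⟨f Z / ⟪w, Z⟫_ℝ, fun X hX Y hY U hU => ?_⟩
    have h1 := hG0 X hX Y hY U hU
    rw [hGapply] at h1
    apply smul_right_injective T hne
    change ⟪w, Z⟫_ℝ • _ = ⟪w, Z⟫_ℝ • _
    rw [smul_smul, mul_div_cancel₀ _ hne]
    linear_combination (norm := module) (1 / 2 : ℝ) • h1
  refine ⟨hw0, ?_⟩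
  obtain ⟨X, hX, Y, hY, hX0, hY0, hXY⟩ := exists_orthogonal_pair hcurv
  have h1 := hG0 X hX Y hY X hX
  rw [hGapply, hw0, real_inner_comm X Y, hXY] at h1
  simpa [hX0, hY0] using h1

/-- `K` and `Q` have no components mixing an irreducible factor with its complement. -/
theorem SatisfiesBianchi.mixed_eq_zero (hB : S.SatisfiesBianchi K Q)
    (hQ : ∀ X Y, Q X Y = -Q Y X) (hK : ∀ Z X Y : T, ⟪K Z X, Y⟫_ℝ = -⟪X, K Z Y⟫_ℝ)
    {W : Submodule ℝ T} (hW : S.IsHolonomyInvariant W)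
    (hirr : ∀ W' ≤ W, S.IsHolonomyInvariant W' → W' = ⊥ ∨ W' = W)
    (hcurv : ¬ S.HasConstantCurvature W) (hcurv' : ¬ S.HasConstantCurvature Wᗮ) :
    (∀ Y ∈ Wᗮ, ∀ U ∈ Wᗮ, ∀ Z ∈ W, ⟪K Y U, Z⟫_ℝ = 0) ∧
    (∀ Y ∈ Wᗮ, ∀ U ∈ Wᗮ, ∀ Z ∈ W, ⟪Q Y Z, U⟫_ℝ = 0) ∧
    (∀ X ∈ W, ∀ Y ∈ W, ∀ Z ∈ W, ⟪Q X Y, Z⟫_ℝ = 0) := by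
  obtain ⟨w, f, hw, hf⟩ := hB.exists_eq_inner_mul hQ hW hirr hcurv
  have h0 := fun Z (hZ : Z ∈ W) => hB.coefficients_eq_zero hQ hK hW hcurv' hw hf hZ
  have hK0 : ∀ Y ∈ Wᗮ, ∀ U ∈ Wᗮ, ∀ Z ∈ W, ⟪K Y U, Z⟫_ℝ = 0 := fun Y hY U hU Z hZ => by
    rw [hw Y hY U hU Z hZ, (h0 Z hZ).1, mul_zero]
  have hQ0 : ∀ Y ∈ Wᗮ, ∀ U ∈ Wᗮ, ∀ Z ∈ W, ⟪Q Y Z, U⟫_ℝ = 0 := fun Y hY U hU Z hZ => by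
    rw [hf Y hY U hU Z hZ, (h0 Z hZ).2, mul_zero]
  refine ⟨hK0, hQ0, fun X hX Y hY Z hZ => ?_⟩
  -- With `Y = U = V` nonzero in `Wᗮ`, only `⟨V, V⟩ pr_W Q(X, Y)` survives in
  -- `curvature_starProjection`.
  obtain ⟨V, hV, _, _, hV0, _, _⟩ := exists_orthogonal_pair hcurv'
  have h1 := hB.curvature_starProjection hQ hW hY hX hV hV
  have h2 : W.starProjection (K V V) = 0 := by
    rw [W.starProjection_apply_eq_zero_iff, Submodule.mem_orthogonal']
    exact hK0 V hV V hV
  have hVV : ⟪V, V⟫_ℝ ≠ 0 := inner_self_ne_zero.2 hV0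
  rw [h2, hQ0 V hV V hV X hX, hQ0 V hV V hV Y hY, map_zero, zero_smul, zero_smul, sub_zero, zero_sub,
    eq_comm, neg_eq_zero, smul_eq_zero, or_iff_right hVV, W.starProjection_apply_eq_zero_iff] at h1
  exact Submodule.inner_left_of_mem_orthogonal hZ h1

end RiemannianSymmetricAlgebra

namespace RiemannianSymmetricAlgebra

variable {𝔤 T : Type*} [LieRing 𝔤] [LieAlgebra ℝ 𝔤] [NormedAddCommGroup T] [InnerProductSpace ℝ T]
  {S : RiemannianSymmetricAlgebra 𝔤 T}

theorem alternating_swap {E : Type*} [AddCommGroup E] [Module ℝ E] (Ψ : T [⋀^Fin 2]→ₗ[ℝ] E)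
    (X Y : T) : Ψ ![X, Y] = -Ψ ![Y, X] := by
  rw [← Ψ.map_swap ![Y, X] (i := 0) (j := 1) (by decide)]
  congr 1
  ext i
  fin_cases i <;> simp

/-- The bilinear map underlying an alternating map in two variables. -/
def bilinOfAlternating {E : Type*} [AddCommGroup E] [Module ℝ E] (Ψ : T [⋀^Fin 2]→ₗ[ℝ] E) :
    T →ₗ[ℝ] T →ₗ[ℝ] E :=
  LinearMap.mk₂ ℝ (fun X Y => Ψ ![X, Y])
    (fun _ _ _ => Ψ.map_vecCons_add _ _ _)
    (fun _ _ _ => Ψ.map_vecCons_smul _ _ _)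
    (fun X Y Y' => by
      rw [alternating_swap, alternating_swap Ψ X Y, alternating_swap Ψ X Y', Ψ.map_vecCons_add,
        neg_add])
    (fun c X Y => by
      rw [alternating_swap, alternating_swap Ψ X Y, Ψ.map_vecCons_smul, smul_neg])

theorem bilinOfAlternating_apply {E : Type*} [AddCommGroup E] [Module ℝ E]
    (Ψ : T [⋀^Fin 2]→ₗ[ℝ] E) (X Y : T) : bilinOfAlternating Ψ X Y = Ψ ![X, Y] := rfl

theorem satisfiesBianchi_of_bianchiTerm {K : T →ₗ[ℝ] Module.End ℝ T} {Ψ : T [⋀^Fin 2]→ₗ[ℝ] T}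
    (h : ∀ X Y Z : T,
      S.bianchiTerm K Ψ X Y Z + S.bianchiTerm K Ψ Y Z X + S.bianchiTerm K Ψ Z X Y = 0) :
    S.SatisfiesBianchi K (bilinOfAlternating Ψ) := by
  intro X Y Z U
  have ht : ∀ X Y Z, S.bianchiTerm K Ψ X Y Z U = K Z (S.curvature X Y U)
      - S.curvature X Y (K Z U) - S.curvature (K X Y - K Y X) Z U
      + ⟪bilinOfAlternating Ψ X Y, U⟫_ℝ • Z - ⟪Z, U⟫_ℝ • bilinOfAlternating Ψ X Y := by
    intro X Y Z
    simp only [bianchiTerm, ad_bracket, LieRing.of_associative_ring_bracket, LinearMap.add_apply,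
      LinearMap.sub_apply, Module.End.mul_apply, LinearMap.neg_apply, map_neg, wedgeOp,
      LinearMap.smulRight_apply, innerₛₗ_apply_apply, bilinOfAlternating_apply]
    module
  rw [← ht, ← ht, ← ht, ← LinearMap.add_apply, ← LinearMap.add_apply, h, LinearMap.zero_apply]

/-! ### Assembling the factors: block-diagonality of `K` and vanishing of `Q`. -/

section Decomposition

variable {N : ℕ} {𝔪 : Fin N → Submodule ℝ T} (h𝔪 : S.IsDeRhamDecomposition 𝔪)

include h𝔪

namespace IsDeRhamDecomposition

theorem ext {E : Type*} [AddCommGroup E] [Module ℝ E] {f g : T →ₗ[ℝ] E}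
    (h : ∀ s, ∀ X ∈ 𝔪 s, f X = g X) : f = g := by
  have h1 : (⊤ : Submodule ℝ T) ≤ LinearMap.eqLocus f g := by
    rw [← h𝔪.internal.submodule_iSup_eq_top]
    exact iSup_le fun s X hX => h s X hX
  exact LinearMap.ext fun X => h1 Submodule.mem_top

theorem eq_zero {v : T} (h : ∀ s, ∀ X ∈ 𝔪 s, ⟪v, X⟫_ℝ = 0) : v = 0 := by
  have h1 : innerₗ T v = 0 := h𝔪.ext h
  exact inner_self_eq_zero.1 (LinearMap.congr_fun h1 v)

theorem mem_orthogonal {r s : Fin N} (hrs : r ≠ s) {X : T} (hX : X ∈ 𝔪 r) : X ∈ (𝔪 s)ᗮ :=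
  h𝔪.orthogonal r s hrs hX

theorem mem [FiniteDimensional ℝ T] {s : Fin N} {v : T}
    (h : ∀ r, r ≠ s → ∀ X ∈ 𝔪 r, ⟪v, X⟫_ℝ = 0) : v ∈ 𝔪 s := by
  obtain ⟨a, ha, b, hb, rfl⟩ := (𝔪 s).exists_add_mem_mem_orthogonal v
  have hb0 : b = 0 := by
    refine h𝔪.eq_zero fun r X hX => ?_
    by_cases hrs : r = s
    · subst hrs
      exact Submodule.inner_left_of_mem_orthogonal hX hb
    · have h1 := h r hrs X hX
      rwa [inner_add_left, Submodule.inner_right_of_mem_orthogonal ha (h𝔪.mem_orthogonal hrs hX),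
        zero_add] at h1
  rwa [hb0, add_zero]

theorem not_hasConstantCurvature_orthogonal (hN : 2 ≤ N)
    (hcurv : ∀ s, ¬ S.HasConstantCurvature (𝔪 s)) (s : Fin N) :
    ¬ S.HasConstantCurvature (𝔪 s)ᗮ := by
  have : Nontrivial (Fin N) := Fin.nontrivial_iff_two_le.2 hN
  obtain ⟨r, hrs⟩ := exists_ne s
  exact fun h => hcurv r (h.mono (h𝔪.orthogonal r s hrs))

end IsDeRhamDecomposition

variable [FiniteDimensional ℝ T] {K : T →ₗ[ℝ] Module.End ℝ T} {Q : T →ₗ[ℝ] T →ₗ[ℝ] T}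

/-- `K` takes values in the block-diagonal operators. -/
theorem SatisfiesBianchi.apply_mem (hB : S.SatisfiesBianchi K Q) (hN : 2 ≤ N)
    (hcurv : ∀ s, ¬ S.HasConstantCurvature (𝔪 s)) (hQ : ∀ X Y, Q X Y = -Q Y X)
    (hK : ∀ Z X Y : T, ⟪K Z X, Y⟫_ℝ = -⟪X, K Z Y⟫_ℝ) (Z : T) {s : Fin N} {X : T} (hX : X ∈ 𝔪 s) :
    K Z X ∈ 𝔪 s := by
  have hmix := fun a => (hB.mixed_eq_zero hQ hK (h𝔪.invariant a) (h𝔪.irreducible a) (hcurv a)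
    (h𝔪.not_hasConstantCurvature_orthogonal hN hcurv a)).1
  refine h𝔪.mem fun c hcs Y hY => ?_
  have h0 : innerₗ T Y ∘ₗ K.flip X = 0 := by
    refine h𝔪.ext fun b Z hZ => ?_
    change ⟪Y, K Z X⟫_ℝ = 0
    -- Of the factors of `Z`, `X`, `Y`, one is met by only one of `X`, `Y` and not by `Z`: it is `c`
    -- if `b = s`, and `s` otherwise (after using skewness).
    by_cases hbs : b = s
    · subst hbs
      rw [real_inner_comm]
      exact hmix c Z (h𝔪.mem_orthogonal hcs.symm hZ) X (h𝔪.mem_orthogonal hcs.symm hX) Y hY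
    · rw [real_inner_comm, hK, real_inner_comm, neg_eq_zero]
      exact hmix s Z (h𝔪.mem_orthogonal hbs hZ) Y (h𝔪.mem_orthogonal hcs hY) X hX
  have h1 : ⟪Y, K Z X⟫_ℝ = 0 := LinearMap.congr_fun h0 Z
  rwa [real_inner_comm]

/-- Components with one argument of `Q` alone in its factor vanish by `mixed_eq_zero`. If only the
value is in a different factor, the cyclic identity reduces to that case. -/
theorem SatisfiesBianchi.bilin_eq_zero (hB : S.SatisfiesBianchi K Q) (hN : 2 ≤ N)
    (hcurv : ∀ s, ¬ S.HasConstantCurvature (𝔪 s)) (hQ : ∀ X Y, Q X Y = -Q Y X)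
    (hK : ∀ Z X Y : T, ⟪K Z X, Y⟫_ℝ = -⟪X, K Z Y⟫_ℝ)
    (hcyc : ∀ X Y Z, ⟪Q X Y, Z⟫_ℝ + ⟪Q Y Z, X⟫_ℝ + ⟪Q Z X, Y⟫_ℝ = 0) : Q = 0 := by
  have hmix := fun a => (hB.mixed_eq_zero hQ hK (h𝔪.invariant a) (h𝔪.irreducible a) (hcurv a)
    (h𝔪.not_hasConstantCurvature_orthogonal hN hcurv a)).2
  have hn : ∀ X Y U, ⟪Q X Y, U⟫_ℝ = -⟪Q Y X, U⟫_ℝ := fun X Y U => by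
    rw [hQ X Y, inner_neg_left]
  refine h𝔪.ext fun a X hX => h𝔪.ext fun b Y hY => h𝔪.eq_zero fun c U hU => ?_
  by_cases hab : a = b
  · subst hab
    by_cases hac : a = c
    · subst hac
      exact (hmix a).2 X hX Y hY U hU
    · have hX' := h𝔪.mem_orthogonal hac hX
      have hY' := h𝔪.mem_orthogonal hac hY
      linarith [hcyc X Y U, (hmix c).1 Y hY' X hX' U hU, (hmix c).1 X hX' Y hY' U hU, hn U X Y]
  · by_cases hac : a = c
    · subst hac
      exact (hmix b).1 X (h𝔪.mem_orthogonal hab hX) U (h𝔪.mem_orthogonal hab hU) Y hY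
    · rw [hn, neg_eq_zero]
      exact (hmix a).1 Y (h𝔪.mem_orthogonal (Ne.symm hab) hY) U
        (h𝔪.mem_orthogonal (Ne.symm hac) hU) X hX

theorem schouten_mul_comm (D : Module.End ℝ T) (hD : ∀ s, ∀ X ∈ 𝔪 s, D X ∈ 𝔪 s) :
    S.schouten * D = D * S.schouten := by
  refine h𝔪.ext fun s X hX => ?_
  obtain ⟨c, hc⟩ := exists_ricci_eq_smul (h𝔪.invariant s) (h𝔪.ne_bot s) (h𝔪.irreducible s)
  simp only [schouten, Module.End.mul_apply, LinearMap.sub_apply, LinearMap.smul_apply, map_sub,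
    map_smul, hc X hX, hc _ (hD s X hX), Module.End.one_apply]

end Decomposition

variable {K : T →ₗ[ℝ] Module.End ℝ T}

/-- Since `K` preserves `W` and `Wᗮ`, the curvature terms pairing `W` with `Wᗮ` vanish, and the
identity becomes Leibniz' rule for `K_Z`. -/
theorem SatisfiesBianchi.derivation (hB : S.SatisfiesBianchi K 0) {W : Submodule ℝ T}
    (hW : S.IsHolonomyInvariant W) (hKW : ∀ Z, ∀ X ∈ W, K Z X ∈ W)
    (hKW' : ∀ Z, ∀ X ∈ Wᗮ, K Z X ∈ Wᗮ) {X Y Z : T} (hX : X ∈ W) (hY : Y ∈ W) (hZ : Z ∈ Wᗮ) :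
    K Z * S.curvature X Y - S.curvature X Y * K Z
      = S.curvature (K Z X) Y + S.curvature X (K Z Y) := by
  ext U
  have h := hB X Y Z U
  rw [hW.curvature_eq_zero (W.sub_mem (hKW X Y hY) (hKW Y X hX)) hZ, hW.curvature_eq_zero hY hZ,
    hW.curvature_eq_zero' hZ hX] at h
  simp only [map_sub, LinearMap.sub_apply, LinearMap.zero_apply, map_zero, inner_zero_left,
    smul_zero, zero_smul, hW.curvature_eq_zero' (hKW' Y Z hZ) hX,
    hW.curvature_eq_zero' (hKW' X Z hZ) hY] at h
  rw [S.curvature_swap (K Z Y) X, LinearMap.neg_apply] at h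
  simp only [LinearMap.sub_apply, LinearMap.add_apply, Module.End.mul_apply]
  linear_combination (norm := module) h

/-- A family of operators, linear in a parameter, with values in the image of the isotropy algebra
of a factor lifts linearly to the isotropy algebra. -/
theorem exists_linearMap_factorIsotropy {W V : Submodule ℝ T} (K : T →ₗ[ℝ] Module.End ℝ T)
    (h : ∀ Z ∈ V, ∃ A ∈ S.factorIsotropy W, ∀ X ∈ W, K Z X = S.ad A X) :
    ∃ P : V →ₗ[ℝ] S.factorIsotropy W, ∀ (Z : V), ∀ X ∈ W, K Z X = S.ad (P Z) X := by
  let L : S.factorIsotropy W →ₗ[ℝ] (W →ₗ[ℝ] T) :=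
    (LinearMap.lcomp ℝ T W.subtype) ∘ₗ S.ad ∘ₗ (S.factorIsotropy W).subtype
  let M : V →ₗ[ℝ] (W →ₗ[ℝ] T) := (LinearMap.lcomp ℝ T W.subtype) ∘ₗ K ∘ₗ V.subtype
  have hM : ∀ Z, M Z ∈ LinearMap.range L := by
    rintro ⟨Z, hZ⟩
    obtain ⟨A, hA, hAX⟩ := h Z hZ
    exact ⟨⟨A, hA⟩, LinearMap.ext fun X => (hAX X X.2).symm⟩
  have : Module.Free ℝ (LinearMap.range L) := Module.Free.of_divisionRing ℝ _
  have : Module.Projective ℝ (LinearMap.range L) := Module.Projective.of_free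
  -- A linear section of `L` over its range chooses `A` linearly in `Z`, with no appeal to
  -- uniqueness of `A`.
  obtain ⟨g, hg⟩ := L.rangeRestrict.exists_rightInverse_of_surjective L.range_rangeRestrict
  refine ⟨g ∘ₗ M.codRestrict _ hM, fun Z X hX => ?_⟩
  have h1 := congrArg Subtype.val (LinearMap.congr_fun hg ⟨M Z, hM Z⟩)
  exact (LinearMap.congr_fun h1 ⟨X, hX⟩).symm

end RiemannianSymmetricAlgebra
end

theorem proposition2 {𝔤 T : Type*} [LieRing 𝔤] [LieAlgebra ℝ 𝔤]
    [NormedAddCommGroup T] [InnerProductSpace ℝ T] [FiniteDimensional ℝ T]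
    (S : RiemannianSymmetricAlgebra 𝔤 T)
    {N : ℕ} (hN : 2 ≤ N) (𝔪 : Fin N → Submodule ℝ T)
    (h𝔪 : S.IsDeRhamDecomposition 𝔪)
    (hcurv : ∀ s, ¬ S.HasConstantCurvature (𝔪 s))
    (K : T →ₗ[ℝ] Module.End ℝ T) (hK : ∀ Z X Y : T, ⟪K Z X, Y⟫_ℝ = -⟪X, K Z Y⟫_ℝ)
    (Ψ : T [⋀^Fin 2]→ₗ[ℝ] T)
    (h6 : ∀ X Y Z : T,
      ⟪Ψ ![X, Y], Z⟫_ℝ + ⟪Ψ ![Y, Z], X⟫_ℝ + ⟪Ψ ![Z, X], Y⟫_ℝ = 0)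
    (h7 : ∀ X Y Z : T,
      S.bianchiTerm K Ψ X Y Z + S.bianchiTerm K Ψ Y Z X + S.bianchiTerm K Ψ Z X Y = 0)
    (Φ : T → T → T)
    (h5 : ∀ X Y : T,
      Ψ ![X, Y] = Φ X Y + ⁅S.schouten, K X⁆ Y - ⁅S.schouten, K Y⁆ X) :
    (Ψ = 0 ∧ Φ = 0) ∧
    (∀ Z : T, ∀ s, ∀ X ∈ 𝔪 s, K Z X ∈ 𝔪 s) ∧
    (∀ s r, s ≠ r → ∃ P : 𝔪 r →ₗ[ℝ] S.factorIsotropy (𝔪 s),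
      ∀ (Z : 𝔪 r), ∀ X ∈ 𝔪 s, K Z X = S.ad (P Z) X) := by
  have hB := RiemannianSymmetricAlgebra.satisfiesBianchi_of_bianchiTerm h7
  have hQ := RiemannianSymmetricAlgebra.alternating_swap Ψ
  have hQ0 := hB.bilin_eq_zero h𝔪 hN hcurv hQ hK h6
  have hKm : ∀ Z : T, ∀ s, ∀ X ∈ 𝔪 s, K Z X ∈ 𝔪 s :=
    fun Z s X hX => hB.apply_mem h𝔪 hN hcurv hQ hK Z hX
  have hΨ : ∀ X Y, Ψ ![X, Y] = 0 := fun X Y =>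
    LinearMap.congr_fun (LinearMap.congr_fun hQ0 X) Y
  refine ⟨⟨?_, ?_⟩, hKm, fun s r hsr => ?_⟩
  · ext v
    have hv : v = ![v 0, v 1] := by
      ext i
      fin_cases i <;> rfl
    rw [hv, hΨ, AlternatingMap.zero_apply]
  · funext X Y
    have hcomm : ∀ X, ⁅S.schouten, K X⁆ = 0 := fun X => by
      rw [LieRing.of_associative_ring_bracket,
        RiemannianSymmetricAlgebra.schouten_mul_comm h𝔪 _ (hKm X), sub_self]
    have h := h5 X Y
    rw [hΨ, hcomm, hcomm, LinearMap.zero_apply, LinearMap.zero_apply, add_zero, sub_zero] at h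
    exact h.symm
  · rw [hQ0] at hB
    refine RiemannianSymmetricAlgebra.exists_linearMap_factorIsotropy K fun Z hZ => ?_
    refine RiemannianSymmetricAlgebra.exists_ad_eq_of_derivation (h𝔪.invariant s)
      (h𝔪.irreducible s) (hcurv s) (K Z) (hK Z) (hKm Z s) fun X hX Y hY => ?_
    refine hB.derivation (h𝔪.invariant s) (fun Z X hX => hKm Z s X hX) (fun Z X hX => ?_) hX hY
      (h𝔪.mem_orthogonal hsr.symm hZ)
    -- A skew operator preserving `𝔪 s` preserves its orthogonal complement.
    rw [Submodule.mem_orthogonal']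
    intro V hV
    rw [hK, Submodule.inner_left_of_mem_orthogonal (hKm Z s V hV) hX, neg_zero]
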